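/- **Fibration lemma.** For a finite simplicial complex $L$ let $\operatorname{cone}(L)=L\times[0,\infty)/L\times\{0\}$ be the open cone on $L$ (for $L=\emptyset$ it is the apex alone). A continuous map $F:\operatorname{cone}(L)\to X$ to a proper metric space $X$ is called *proper expanding* if it is proper and, for any two disjoint simplices $\sigma,\tau$ of $L$, $$d\bigl(F(\sigma\times[t,\infty)),F(\tau\times[t,\infty))\bigr)\to\infty\quad\text{as }t\to\infty,$$ where $d(A,B)=\inf_{a\in A,\,b\in B}d(a,b)$. Let $G$ be a connected Lie group, $H\subset G$ a closed subgroup, let $Q$ be the homogeneous space of cosets $Hg$, $g\in G$ (the quotient of $G$ by left translations by $H$), with the quotient topology and the quotient map $\pi:G\to Q$, $\pi(g)=Hg$, and assume that $Q$ is contractible. Let $G$ be equipped with a proper metric, inducing its topology, that is invariant under left translations, let $H$ carry the subspace metric, and let $Q$ be equipped with a proper metric, inducing its topology, such that $\pi$ is Lipschitz. Let $K_H$ and $K_Q$ be finite simplicial complexes and let $\alpha:\operatorname{cone}(K_H)\to H$ and $\beta:\operatorname{cone}(K_Q)\to Q$ be proper expanding maps. Then there is a proper expanding map $F:\operatorname{cone}(K_H*K_Q)\to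 G$, where $K_H*K_Q$ is the simplicial join, such that the image of $F$ is contained in $\pi^{-1}\bigl(\beta(\operatorname{cone}(K_Q))\bigr)$. -/

import Mathlib

open Filter Topology
open scoped Manifold ContDiff NNReal

/-! ### Finite simplicial complexes: realization, open cone, join -/

namespace AbstractSimplicialComplex

variable {V W : Type*}

/-- The join `K * L` of two simplicial complexes. Its vertex set is the disjoint union of the two
vertex sets, and its simplices are the nonempty sets `σ ⊔ τ` where `σ` is a simplex of `K` or empty
and `τ` is a simplex of `L` or empty. -/
def join (K : AbstractSimplicialComplex V) (L : AbstractSimplicialComplex W) :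
    AbstractSimplicialComplex (V ⊕ W) where
  faces := {s | s.Nonempty ∧ (s.toLeft = ∅ ∨ s.toLeft ∈ K) ∧ (s.toRight = ∅ ∨ s.toRight ∈ L)}
  isRelLowerSet_faces := by
    rintro s ⟨hs, hK, hL⟩
    refine ⟨hs, fun t hts ht => ⟨ht, ?_, ?_⟩⟩
    · have hsub : t.toLeft ⊆ s.toLeft := Finset.toLeft_subset_toLeft hts
      rcases Finset.eq_empty_or_nonempty t.toLeft with h | h
      · exact Or.inl h
      · rcases hK with hK | hK
        · exact Or.inl (Finset.subset_empty.mp (hK ▸ hsub))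
        · exact Or.inr ((K.isRelLowerSet_faces hK).2 hsub h)
    · have hsub : t.toRight ⊆ s.toRight := Finset.toRight_subset_toRight hts
      rcases Finset.eq_empty_or_nonempty t.toRight with h | h
      · exact Or.inl h
      · rcases hL with hL | hL
        · exact Or.inl (Finset.subset_empty.mp (hL ▸ hsub))
        · exact Or.inr ((L.isRelLowerSet_faces hL).2 hsub h)
  singleton_mem := by
    rintro (v | w)
    · refine ⟨Finset.singleton_nonempty _, Or.inr ?_, Or.inl ?_⟩
      · have : ({Sum.inl v} : Finset (V ⊕ W)).toLeft = {v} := by ext; simp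
        rw [this]
        exact K.singleton_mem v
      · ext; simp
    · refine ⟨Finset.singleton_nonempty _, Or.inl ?_, Or.inr ?_⟩
      · ext; simp
      · have : ({Sum.inr w} : Finset (V ⊕ W)).toRight = {w} := by ext; simp
        rw [this]
        exact L.singleton_mem w

variable [Fintype V]

/-- The geometric realization `|L|` of a finite simplicial complex, in barycentric coordinates. -/
abbrev Realization (L : AbstractSimplicialComplex V) : Type _ :=
  {p : V → ℝ // p ∈ stdSimplex ℝ V ∧ ∃ σ ∈ L, ∀ v, v ∉ σ → p v = 0}

/-- The open cone `L × [0,∞) / L × {0}` on a finite simplicial complex `L`. The class of `(p, t)`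
is represented by the vector `t • p`, where `p` is given by its barycentric coordinates, and the
apex is `0`; see `isQuotientMap_coneMk` and `coneMk_eq_coneMk_iff` below for the comparison with
the quotient. The cone on the empty complex is the apex alone. -/
abbrev Cone (L : AbstractSimplicialComplex V) : Type _ :=
  {x : V → ℝ // x = 0 ∨ (∀ v, 0 ≤ x v) ∧ ∃ σ ∈ L, ∀ v, v ∉ σ → x v = 0}

/-- For a simplex `σ` of `L`, the part `σ × [t,∞)` of the open cone on `L`; the height of the point
`s • p` is `s`, the sum of its coordinates. -/
def coneFrom (L : AbstractSimplicialComplex V) (σ : Finset V) (t : ℝ) : Set L.Cone :=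
  {x | (∀ v, v ∉ σ → x.1 v = 0) ∧ t ≤ ∑ v, x.1 v}

/-- The canonical map `|L| × [0,∞) → cone(L)`. -/
def coneMk (L : AbstractSimplicialComplex V) (q : L.Realization × ℝ≥0) : L.Cone :=
  ⟨fun v => (q.2 : ℝ) * q.1.1 v, Or.inr ⟨fun v => mul_nonneg q.2.2 (q.1.2.1.1 v), by
    obtain ⟨σ, hσ, h⟩ := q.1.2.2
    exact ⟨σ, hσ, fun v hv => mul_eq_zero_of_right _ (h v hv)⟩⟩⟩

/-- The canonical map identifies exactly the points of height `0`. -/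
theorem coneMk_eq_coneMk_iff (L : AbstractSimplicialComplex V) (q r : L.Realization × ℝ≥0) :
    L.coneMk q = L.coneMk r ↔ q = r ∨ (q.2 = 0 ∧ r.2 = 0) := by
  obtain ⟨p, s⟩ := q
  obtain ⟨p', s'⟩ := r
  constructor
  · intro h
    have hv : ∀ v, (s : ℝ) * p.1 v = (s' : ℝ) * p'.1 v := fun v => congrFun (congrArg Subtype.val h) v
    have hs : s = s' := by
      have := Finset.sum_congr rfl (fun v (_ : v ∈ Finset.univ) => hv v)
      rw [← Finset.mul_sum, ← Finset.mul_sum, p.2.1.2, p'.2.1.2, mul_one, mul_one] at this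
      exact_mod_cast this
    subst hs
    by_cases h0 : s = 0
    · exact Or.inr ⟨h0, h0⟩
    · left
      have : p = p' := Subtype.ext (funext fun v =>
        mul_left_cancel₀ (NNReal.coe_ne_zero.mpr h0) (hv v))
      rw [this]
  · rintro (h | ⟨h, h'⟩)
    · rw [h]
    · simp only at h h'
      subst h; subst h'
      apply Subtype.ext
      simp [coneMk]

/-- For nonempty `L`, the space `Cone L` carries the quotient topology from `|L| × [0,∞)`. -/
theorem isQuotientMap_coneMk [Nonempty V] (L : AbstractSimplicialComplex V) :
    IsQuotientMap L.coneMk := by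
  have hcont : Continuous L.coneMk :=
    Continuous.subtype_mk (continuous_pi fun v =>
      (NNReal.continuous_coe.comp continuous_snd).mul
        ((continuous_apply v).comp (continuous_subtype_val.comp continuous_fst))) _
  have hcpt : CompactSpace L.Realization := by
    refine isCompact_iff_compactSpace.mp
      (?_ : IsCompact {p : V → ℝ | p ∈ stdSimplex ℝ V ∧ ∃ σ ∈ L, ∀ v, v ∉ σ → p v = 0})
    have : {p : V → ℝ | p ∈ stdSimplex ℝ V ∧ ∃ σ ∈ L, ∀ v, v ∉ σ → p v = 0} =
        stdSimplex ℝ V ∩ ⋃ σ ∈ {σ : Finset V | σ ∈ L}, {p | ∀ v, v ∉ σ → p v = 0} := by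
      ext p; simp
    rw [this]
    refine (isCompact_stdSimplex ℝ V).inter_right
      (Set.Finite.isClosed_biUnion (Set.toFinite _) fun σ _ => ?_)
    simp only [Set.ofPred_forall]
    exact isClosed_iInter fun v => isClosed_iInter fun _ =>
      isClosed_eq (continuous_apply v) continuous_const
  have hprop : IsProperMap L.coneMk := by
    refine isProperMap_iff_isCompact_preimage.mpr ⟨hcont, fun C hC => ?_⟩
    have hcs : Continuous (fun x : L.Cone => ∑ v, x.1 v) :=
      continuous_finsetSum _ fun v _ => (continuous_apply v).comp continuous_subtype_val
    obtain ⟨M, hM⟩ := (hC.image hcs).bddAbove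
    refine (isCompact_univ.prod (isCompact_Icc (a := (0 : ℝ≥0)) (b := M.toNNReal))).of_isClosed_subset
      (hC.isClosed.preimage hcont) fun q hq => ⟨Set.mem_univ _, zero_le, ?_⟩
    have h := hM ⟨_, hq, rfl⟩
    simp only [coneMk] at h
    rw [← Finset.mul_sum, q.1.2.1.2, mul_one] at h
    exact NNReal.le_toNNReal_of_coe_le h
  refine hprop.isClosedMap.isQuotientMap hcont fun x => ?_
  obtain ⟨v₀⟩ := ‹Nonempty V›
  classical
  have hsing : L.Realization := ⟨Pi.single v₀ 1, single_mem_stdSimplex ℝ v₀, {v₀},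
    L.singleton_mem v₀, fun v hv => Pi.single_eq_of_ne (by simpa using hv) 1⟩
  by_cases hx : x.1 = 0
  · exact ⟨(hsing, 0), Subtype.ext (by rw [hx]; funext v; simp [coneMk])⟩
  · obtain ⟨hn, σ, hσ, h0⟩ := x.2.resolve_left hx
    have hpos : 0 < ∑ v, x.1 v := by
      refine lt_of_le_of_ne (Finset.sum_nonneg fun v _ => hn v) fun h => hx (funext fun v => ?_)
      exact (Finset.sum_eq_zero_iff_of_nonneg fun v _ => hn v).mp h.symm v (Finset.mem_univ v)
    refine ⟨(⟨fun v => (∑ w, x.1 w)⁻¹ * x.1 v, ⟨fun v => mul_nonneg (inv_nonneg.mpr hpos.le) (hn v),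
      ?_⟩, σ, hσ, fun v hv => mul_eq_zero_of_right _ (h0 v hv)⟩, ⟨∑ w, x.1 w, hpos.le⟩), Subtype.ext ?_⟩
    · rw [← Finset.mul_sum]
      exact inv_mul_cancel₀ hpos.ne'
    · funext v
      exact mul_inv_cancel_left₀ hpos.ne' _

end AbstractSimplicialComplex

/-! ### Proper expanding maps -/

/-- The distance `d(A, B) = inf {d(a, b) | a ∈ A, b ∈ B}` between two subsets of a metric space. -/
noncomputable def setEDist {X : Type*} [MetricSpace X] (A B : Set X) : ENNReal :=
  ⨅ a ∈ A, ⨅ b ∈ B, edist a b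

/-- A map `F : cone(L) → X` to a (proper) metric space is proper expanding if it is continuous and
proper, and for all disjoint simplices `σ`, `τ` of `L` the distance
`d(F(σ × [t,∞)), F(τ × [t,∞)))` tends to infinity as `t → ∞`. -/
def IsProperExpanding {V : Type*} [Fintype V] {L : AbstractSimplicialComplex V}
    {X : Type*} [MetricSpace X] (F : L.Cone → X) : Prop :=
  IsProperMap F ∧ ∀ σ ∈ L, ∀ τ ∈ L, Disjoint σ τ →
    Tendsto (fun t : ℝ => setEDist (F '' L.coneFrom σ t) (F '' L.coneFrom τ t)) atTop (𝓝 ⊤)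

/-! ### The homogeneous space -/

/-- The set of cosets `H g`, i.e. the quotient of `G` by the action of `H` by left translations.
No topology is put on it here. -/
def CosetSpace {G : Type*} [Group G] (H : Subgroup G) : Type _ :=
  Quotient (QuotientGroup.rightRel H)

/-- The quotient map `g ↦ H g`. -/
def CosetSpace.mk {G : Type*} [Group G] (H : Subgroup G) (g : G) : CosetSpace H :=
  Quotient.mk (QuotientGroup.rightRel H) g

/-!
The open cone on the join is the product of the open cones, so a point of it is a pair `(x, y)` with
`x ∈ cone(K_H)` and `y ∈ cone(K_Q)`. If `s : cone(K_Q) → G` is a lift of `β`, the map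
`F (x, y) = α x * s y` does what is wanted. It maps to `π⁻¹ (range β)` because `π (F (x, y)) = β y`.
It is proper expanding (`AbstractSimplicialComplex.isProperExpanding_mul_lift`): if `F (x, y)` and
`F (x', y')` are close, over disjoint simplices, then so are `β y` and `β y'` as `π` is Lipschitz;
hence `y`, `y'` are bounded, `s y` and `s y'` stay in a compact set, and by left invariance `α x` and
`α x'` are at bounded distance, so that `x`, `x'` are bounded too. Properness is shown in the same
way.

The lift exists because the open cone is contractible and `π : G → H \ G` has local sections. The
lifting (`AbstractSimplicialComplex.Cone.exists_lift`) follows the radial contraction of the cone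
over an exhausting sequence of compact subsets, with a form of homotopy lifting
(`CosetSpace.exists_lift_of_homotopy`) that leaves the lift unchanged where the homotopy is
stationary.

The local sections come from a compact slice transverse to `H` at `1`
(`LieGroup.exists_compact_slice`), which is obtained without the exponential map. Strict
differentiability of the multiplication gives a chart `φ` at `1` with
`φ (x * y) = φ x + φ y + o(‖φ x‖)`. In it the limits of directions of elements of `H` tending to `1`
lie in a linear subspace, the tangent space of `H` (`IsAdditiveChart.tangentSpace`,
`IsAdditiveChart.mem_tangentSpace_of_direction`). The slice is a small ball in a complement. It
meets each coset at most once since small elements of `H` are almost tangent to `H`, and it meets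
every coset close to that of `1` since the tangential coordinate of `h * g`, minimized over the small
elements `h` of `H`, must vanish.
-/

/-! ### A chart at the identity of a Lie group -/

section LieGroupChart

variable {E : Type*} [NormedAddCommGroup E] [NormedSpace ℝ E]
  {G : Type*} [Group G] [TopologicalSpace G] [ChartedSpace E G] [LieGroup 𝓘(ℝ, E) ∞ G]

/-- In a suitable chart at `1`, multiplication is addition up to an error that is small relative to
the first factor: multiplication is strictly differentiable at `(1, 1)`, its derivative in the first
variable is the identity, and the pairs `(x, y)` and `(1, y)` are compared. -/
theorem LieGroup.exists_chart_mul_approx : ∃ φ : OpenPartialHomeomorph G E,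
    1 ∈ φ.source ∧ φ 1 = 0 ∧ ∀ ε > 0, ∀ᶠ p : G × G in 𝓝 (1, 1),
      ‖φ (p.1 * p.2) - φ p.1 - φ p.2‖ ≤ ε * ‖φ p.1‖ := by
  have hG : IsTopologicalGroup G := topologicalGroup_of_lieGroup 𝓘(ℝ, E) ∞
  set ψ := chartAt E (1 : G) with hψ
  set c := ψ 1 with hc
  have h1 : (1 : G) ∈ ψ.source := mem_chart_source E 1
  set μ : E × E → E := fun p => ψ (ψ.symm p.1 * ψ.symm p.2) with hμ
  have hcd : ContDiffAt ℝ ∞ μ (c, c) := by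
    have h := (contMDiff_mul 𝓘(ℝ, E) ∞ (G := G)).contMDiffAt (x := ((1 : G), (1 : G)))
    rw [contMDiffAt_iff] at h
    have h2 := h.2
    simp only [extChartAt_prod] at h2
    simp at h2
    rw [← contDiffWithinAt_univ]
    exact h2
  obtain ⟨D, hD⟩ : ∃ D, HasStrictFDerivAt μ D (c, c) :=
    ⟨_, hcd.hasStrictFDerivAt (by simp)⟩
  have hsymm : ψ.symm c = 1 := ψ.left_inv h1
  have hDu : ∀ u, D (u, 0) = u := by
    have e1 : HasFDerivAt (fun u => μ (u, c)) (D.comp (ContinuousLinearMap.inl ℝ E E)) c :=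
      HasFDerivAt.comp (f := fun u => (u, c)) c hD.hasFDerivAt (hasFDerivAt_prodMk_left c c)
    have e2 : (fun u => μ (u, c)) =ᶠ[𝓝 c] id := by
      filter_upwards [ψ.open_target.mem_nhds (ψ.map_source h1)] with u hu
      simp [hμ, hsymm, ψ.right_inv hu]
    have := e1.unique ((hasFDerivAt_id c).congr_of_eventuallyEq e2)
    intro u
    simpa using DFunLike.congr_fun this u
  refine ⟨ψ.transHomeomorph (Homeomorph.addRight (-c)), h1, by simp [← hc], fun ε hε => ?_⟩
  have hs := hD.isLittleO.def hε
  have hcont : ContinuousAt ψ 1 := ψ.continuousAt h1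
  have ht : Tendsto (fun p : G × G => ((ψ p.1, ψ p.2), (c, ψ p.2))) (𝓝 (1, 1))
      (𝓝 ((c, c), (c, c))) := by
    have a1 : Tendsto (fun p : G × G => ψ p.1) (𝓝 (1, 1)) (𝓝 c) :=
      hcont.tendsto.comp (continuous_fst.tendsto _)
    have a2 : Tendsto (fun p : G × G => ψ p.2) (𝓝 (1, 1)) (𝓝 c) :=
      hcont.tendsto.comp (continuous_snd.tendsto _)
    exact (a1.prodMk_nhds a2).prodMk_nhds (tendsto_const_nhds.prodMk_nhds a2)
  have hsrc : ψ.source ∈ 𝓝 (1 : G) := ψ.open_source.mem_nhds h1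
  filter_upwards [ht.eventually hs, prod_mem_nhds hsrc hsrc] with p hp hp'
  have e3 : ((ψ p.1, ψ p.2) : E × E) - (c, ψ p.2) = (ψ p.1 - c, 0) := by simp
  rw [e3, hDu] at hp
  simp only [hμ, ψ.left_inv hp'.1, ψ.left_inv hp'.2, hsymm, one_mul] at hp
  simp [Prod.norm_def] at hp ⊢
  rw [← sub_eq_add_neg, ← sub_eq_add_neg]
  have e4 : ψ (p.1 * p.2) - ψ p.1 - (ψ p.2 - c) = ψ (p.1 * p.2) - ψ p.2 - (ψ p.1 - c) := by abel
  rwa [e4]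

end LieGroupChart

/-! ### The tangent space of a subgroup -/

section TangentSpace

variable {E : Type*} [NormedAddCommGroup E] {G : Type*} [Group G] [TopologicalSpace G]

theorem OpenPartialHomeomorph.exists_radius_of_mem_nhds {φ : OpenPartialHomeomorph G E}
    (h1 : 1 ∈ φ.source) (h0 : φ 1 = 0) {U : Set G} (hU : U ∈ 𝓝 1) :
    ∃ r > 0, ∀ x ∈ φ.source, ‖φ x‖ < r → x ∈ U := by
  have h : Tendsto φ.symm (𝓝 0) (𝓝 1) := by
    have := φ.symm.continuousAt (x := φ 1) (φ.map_source h1)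
    rwa [ContinuousAt, φ.left_inv h1, h0] at this
  obtain ⟨r, hr, hrU⟩ := Metric.mem_nhds_iff.mp (h hU)
  refine ⟨r, hr, fun x hx hxr => ?_⟩
  have := hrU (mem_ball_zero_iff.mpr hxr)
  rwa [Set.mem_preimage, φ.left_inv hx] at this

/-- A chart at the identity, sending it to `0`, in which `x * y` is the sum of `x` and `y` up to an
error `o(‖φ x‖)`. -/
structure IsAdditiveChart (φ : OpenPartialHomeomorph G E) : Prop where
  one_mem : 1 ∈ φ.source
  map_one : φ 1 = 0
  mul_approx : ∀ ε > 0, ∀ᶠ p : G × G in 𝓝 (1, 1),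
    ‖φ (p.1 * p.2) - φ p.1 - φ p.2‖ ≤ ε * ‖φ p.1‖

namespace IsAdditiveChart

variable {φ : OpenPartialHomeomorph G E} (hφ : IsAdditiveChart φ)
include hφ

theorem source_mem : φ.source ∈ 𝓝 1 := φ.open_source.mem_nhds hφ.one_mem

/-- The chart almost turns powers into multiples, as long as these stay in the chart. -/
theorem pow_approx [NormedSpace ℝ E] {ε r : ℝ} (hε : ε ≤ 1) (hr : ∀ x ∈ φ.source, ∀ y ∈ φ.source,
    ‖φ x‖ < r → ‖φ y‖ < r → x * y ∈ φ.source ∧ ‖φ (x * y) - φ x - φ y‖ ≤ ε * ‖φ x‖)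
    {h : G} (hh : h ∈ φ.source) (hhr : ‖φ h‖ < r) (k : ℕ) (hk : 2 * (k * ‖φ h‖) < r) :
    h ^ k ∈ φ.source ∧ ‖φ (h ^ k) - (k : ℝ) • φ h‖ ≤ ε * (k * ‖φ h‖) := by
  induction k with
  | zero => simp [hφ.one_mem, hφ.map_one]
  | succ k ih =>
    have hn := norm_nonneg (φ h)
    push_cast at hk
    obtain ⟨i1, i2⟩ := ih (by nlinarith)
    have hlt : ‖φ (h ^ k)‖ < r := by
      have e1 : ‖φ (h ^ k)‖ ≤ ‖φ (h ^ k) - (k : ℝ) • φ h‖ + ‖(k : ℝ) • φ h‖ := by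
        simpa using norm_add_le (φ (h ^ k) - (k : ℝ) • φ h) ((k : ℝ) • φ h)
      rw [norm_smul, Real.norm_natCast] at e1
      have : ε * (k * ‖φ h‖) ≤ 1 * (k * ‖φ h‖) := by gcongr
      linarith
    obtain ⟨j1, j2⟩ := hr h hh _ i1 hhr hlt
    rw [pow_succ']
    refine ⟨j1, ?_⟩
    have e : φ (h * h ^ k) - ((k + 1 : ℕ) : ℝ) • φ h
        = (φ (h * h ^ k) - φ h - φ (h ^ k)) + (φ (h ^ k) - (k : ℝ) • φ h) := by
      push_cast; rw [add_smul, one_smul]; abel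
    rw [e]
    refine (norm_add_le _ _).trans ?_
    push_cast
    linarith

variable [IsTopologicalGroup G]

theorem mul_mem_and_approx {ε : ℝ} (hε : 0 < ε) : ∃ r > 0, ∀ x ∈ φ.source, ∀ y ∈ φ.source,
    ‖φ x‖ < r → ‖φ y‖ < r → x * y ∈ φ.source ∧ ‖φ (x * y) - φ x - φ y‖ ≤ ε * ‖φ x‖ := by
  have hm : Tendsto (fun p : G × G => p.1 * p.2) (𝓝 (1, 1)) (𝓝 1) := by
    have := (continuous_mul (M := G)).tendsto (1, 1)
    rwa [mul_one] at this
  have hs : ∀ᶠ x in 𝓝 1, x ∈ φ.source := hφ.source_mem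
  have h := (hm.eventually hs).and (hφ.mul_approx ε hε)
  rw [nhds_prod_eq] at h
  obtain ⟨U, hU, V, hV, hUV⟩ := mem_prod_iff.mp h
  obtain ⟨r, hr, hrU⟩ :=
    OpenPartialHomeomorph.exists_radius_of_mem_nhds hφ.one_mem hφ.map_one (inter_mem hU hV)
  exact ⟨r, hr, fun x hx y hy hxr hyr => hUV (Set.mk_mem_prod (hrU x hx hxr).1 (hrU y hy hyr).2)⟩

theorem inv_mem_and_approx {ε : ℝ} (hε : 0 < ε) : ∃ r > 0, ∀ x ∈ φ.source,
    ‖φ x‖ < r → x⁻¹ ∈ φ.source ∧ ‖φ x⁻¹ + φ x‖ ≤ ε * ‖φ x‖ := by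
  have hi : Tendsto (fun x : G => x⁻¹) (𝓝 1) (𝓝 1) := by
    have := (continuous_inv (G := G)).tendsto 1
    rwa [inv_one] at this
  have hp : Tendsto (fun x : G => (x, x⁻¹)) (𝓝 1) (𝓝 (1, 1)) := tendsto_id.prodMk_nhds hi
  obtain ⟨r, hr, hrU⟩ := OpenPartialHomeomorph.exists_radius_of_mem_nhds hφ.one_mem hφ.map_one
    (inter_mem (hi hφ.source_mem) (hp (hφ.mul_approx ε hε)))
  refine ⟨r, hr, fun x hx hxr => ⟨(hrU x hx hxr).1, ?_⟩⟩
  have := (hrU x hx hxr).2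
  simp only [Set.mem_preimage, Set.mem_ofPred_eq, mul_inv_cancel, hφ.map_one] at this
  have e : φ x⁻¹ + φ x = -(0 - φ x - φ x⁻¹) := by abel
  rwa [e, norm_neg]

end IsAdditiveChart

variable [NormedSpace ℝ E] [IsTopologicalGroup G]

/-- The tangent space at the identity of a subgroup `H`, in an additive chart `φ`: the vectors `v`
such that for all small `τ > 0` some `h ∈ H` has `φ h = τ v + o(τ)`. Sums and negatives of tangent
vectors are realized by products and inverses in `H`. -/
def IsAdditiveChart.tangentSpace {φ : OpenPartialHomeomorph G E} (hφ : IsAdditiveChart φ)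
    (H : Subgroup G) : Submodule ℝ E where
  carrier := {v | ∀ ε > 0, ∃ τ₀ > 0, ∀ τ, 0 < τ → τ < τ₀ →
    ∃ h ∈ H, h ∈ φ.source ∧ ‖φ h - τ • v‖ ≤ ε * τ}
  zero_mem' := fun ε hε => ⟨1, one_pos, fun τ hτ _ =>
    ⟨1, H.one_mem, hφ.one_mem, by simp [hφ.map_one]; positivity⟩⟩
  add_mem' := by
    intro v w hv hw ε hε
    have hε' : 0 < min 1 (ε / (3 * (2 + ‖v‖))) := by positivity
    set δ := min 1 (ε / (3 * (2 + ‖v‖))) with hδ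
    obtain ⟨r, hr, hmul⟩ := hφ.mul_mem_and_approx hε'
    obtain ⟨τ₁, hτ₁, H1⟩ := hv δ hε'
    obtain ⟨τ₂, hτ₂, H2⟩ := hw δ hε'
    refine ⟨min (min τ₁ τ₂) (r / (2 + ‖v‖ + ‖w‖)), by positivity, fun τ h0 hτ => ?_⟩
    simp only [lt_min_iff] at hτ
    obtain ⟨⟨l1, l2⟩, l3⟩ := hτ
    rw [lt_div_iff₀ (by positivity)] at l3
    obtain ⟨h, hH, hs, hb⟩ := H1 τ h0 l1
    obtain ⟨k, kH, ks, kb⟩ := H2 τ h0 l2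
    have hδ1 : δ ≤ 1 := min_le_left _ _
    have hδ2 : δ * (3 * (2 + ‖v‖)) ≤ ε := by
      rw [← le_div_iff₀ (by positivity)]; exact min_le_right _ _
    have n1 : ‖φ h‖ ≤ δ * τ + τ * ‖v‖ := by
      have := norm_add_le (φ h - τ • v) (τ • v)
      rw [sub_add_cancel, norm_smul, Real.norm_of_nonneg h0.le] at this
      linarith
    have n2 : ‖φ k‖ ≤ δ * τ + τ * ‖w‖ := by
      have := norm_add_le (φ k - τ • w) (τ • w)
      rw [sub_add_cancel, norm_smul, Real.norm_of_nonneg h0.le] at this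
      linarith
    have hv0 := norm_nonneg v
    have hw0 := norm_nonneg w
    have q : δ * τ ≤ 1 * τ := by gcongr
    have qv := mul_nonneg h0.le hv0
    have qw := mul_nonneg h0.le hw0
    obtain ⟨m1, m2⟩ := hmul h hs k ks (by linarith) (by linarith)
    refine ⟨h * k, H.mul_mem hH kH, m1, ?_⟩
    have e : φ (h * k) - τ • (v + w)
        = (φ (h * k) - φ h - φ k) + (φ h - τ • v) + (φ k - τ • w) := by
      rw [smul_add]; abel
    rw [e]
    refine (norm_add₃_le).trans ?_
    have : δ * ‖φ h‖ ≤ δ * (τ + τ * ‖v‖) := by gcongr; linarith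
    have q2 : δ * (3 * (2 + ‖v‖)) * τ ≤ ε * τ := by gcongr
    have q3 : 0 ≤ δ * (τ * ‖v‖) := by positivity
    have q4 : 0 ≤ δ * τ := by positivity
    nlinarith
  smul_mem' := by
    have pos : ∀ c : ℝ, 0 < c → ∀ v : E, (∀ ε > 0, ∃ τ₀ > 0, ∀ τ, 0 < τ → τ < τ₀ →
        ∃ h ∈ H, h ∈ φ.source ∧ ‖φ h - τ • v‖ ≤ ε * τ) →
        (∀ ε > 0, ∃ τ₀ > 0, ∀ τ, 0 < τ → τ < τ₀ →
        ∃ h ∈ H, h ∈ φ.source ∧ ‖φ h - τ • (c • v)‖ ≤ ε * τ) := by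
      intro c hc v hv ε hε
      obtain ⟨τ₁, hτ₁, H1⟩ := hv (ε / c) (by positivity)
      refine ⟨τ₁ / c, by positivity, fun τ h0 hτ => ?_⟩
      obtain ⟨h, hH, hs, hb⟩ := H1 (τ * c) (by positivity) (by rwa [← lt_div_iff₀ hc])
      refine ⟨h, hH, hs, ?_⟩
      rw [smul_smul]
      convert hb using 1
      field_simp
    have neg : ∀ v : E, (∀ ε > 0, ∃ τ₀ > 0, ∀ τ, 0 < τ → τ < τ₀ →
        ∃ h ∈ H, h ∈ φ.source ∧ ‖φ h - τ • v‖ ≤ ε * τ) →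
        (∀ ε > 0, ∃ τ₀ > 0, ∀ τ, 0 < τ → τ < τ₀ →
        ∃ h ∈ H, h ∈ φ.source ∧ ‖φ h - τ • (-v)‖ ≤ ε * τ) := by
      intro v hv ε hε
      have hδ : 0 < min 1 (ε / (2 + ‖v‖)) := by positivity
      set δ := min 1 (ε / (2 + ‖v‖))
      have hδ1 : δ ≤ 1 := min_le_left _ _
      have hδ2 : δ * (2 + ‖v‖) ≤ ε := by
        rw [← le_div_iff₀ (by positivity)]; exact min_le_right _ _
      obtain ⟨r, hr, hinv⟩ := hφ.inv_mem_and_approx hδ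
      obtain ⟨τ₁, hτ₁, H1⟩ := hv δ hδ
      refine ⟨min τ₁ (r / (1 + ‖v‖)), by positivity, fun τ h0 hτ => ?_⟩
      simp only [lt_min_iff] at hτ
      obtain ⟨l1, l3⟩ := hτ
      rw [lt_div_iff₀ (by positivity)] at l3
      obtain ⟨h, hH, hs, hb⟩ := H1 τ h0 l1
      have q : δ * τ ≤ 1 * τ := by gcongr
      have n1 : ‖φ h‖ ≤ δ * τ + τ * ‖v‖ := by
        have := norm_add_le (φ h - τ • v) (τ • v)
        rw [sub_add_cancel, norm_smul, Real.norm_of_nonneg h0.le] at this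
        linarith
      obtain ⟨m1, m2⟩ := hinv h hs (by linarith)
      refine ⟨h⁻¹, H.inv_mem hH, m1, ?_⟩
      have e : φ h⁻¹ - τ • (-v) = (φ h⁻¹ + φ h) - (φ h - τ • v) := by
        rw [smul_neg]; abel
      rw [e]
      refine (norm_sub_le _ _).trans ?_
      have : δ * ‖φ h‖ ≤ δ * (τ + τ * ‖v‖) := by gcongr; linarith
      have q2 : δ * (2 + ‖v‖) * τ ≤ ε * τ := by gcongr
      nlinarith
    intro c v hv
    rcases lt_trichotomy c 0 with hc | rfl | hc
    · have := neg _ (pos (-c) (by linarith) v hv)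
      simpa using this
    · intro ε hε
      exact ⟨1, one_pos, fun τ hτ _ =>
        ⟨1, H.one_mem, hφ.one_mem, by simp [hφ.map_one]; positivity⟩⟩
    · exact pos c hc v hv

namespace IsAdditiveChart

variable {φ : OpenPartialHomeomorph G E} (hφ : IsAdditiveChart φ) {H : Subgroup G}

theorem mem_tangentSpace {v : E} : v ∈ hφ.tangentSpace H ↔ ∀ ε > 0, ∃ τ₀ > 0, ∀ τ, 0 < τ → τ < τ₀ →
    ∃ h ∈ H, h ∈ φ.source ∧ ‖φ h - τ • v‖ ≤ ε * τ := Iff.rfl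

/-- Limits of directions of elements of `H` tending to `1` are tangent to `H`: the powers of an
element close to `1` fill out the whole ray, up to a small relative error. -/
theorem mem_tangentSpace_of_direction {v : E} (hv : ‖v‖ = 1)
    (h : ∀ ε > 0, ∀ r > 0, ∃ h ∈ H, h ∈ φ.source ∧ 0 < ‖φ h‖ ∧ ‖φ h‖ < r ∧
      ‖φ h - ‖φ h‖ • v‖ ≤ ε * ‖φ h‖) : v ∈ hφ.tangentSpace H := by
  rw [mem_tangentSpace]
  intro ε hε
  have hδ : 0 < min 1 (ε / 3) := by positivity
  set δ := min 1 (ε / 3)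
  have hδ1 : δ ≤ 1 := min_le_left _ _
  have hδ2 : δ ≤ ε / 3 := min_le_right _ _
  obtain ⟨r, hr, hmul⟩ := hφ.mul_mem_and_approx hδ
  refine ⟨r / 2, by positivity, fun τ h0 hτ => ?_⟩
  obtain ⟨x, hxH, hxs, hx0, hxr, hxv⟩ := h δ hδ (min (δ * τ) r) (by positivity)
  obtain ⟨hx1, hx2⟩ := lt_min_iff.mp hxr
  set k := ⌊τ / ‖φ x‖⌋₊
  have k1 : k * ‖φ x‖ ≤ τ := by
    rw [← le_div_iff₀ hx0]; exact Nat.floor_le (by positivity)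
  have k2 : τ < (k + 1) * ‖φ x‖ := by
    rw [← div_lt_iff₀ hx0]; exact Nat.lt_floor_add_one _
  obtain ⟨p1, p2⟩ := hφ.pow_approx hδ1 hmul hxs hx2 k (by linarith)
  refine ⟨x ^ k, H.pow_mem hxH k, p1, ?_⟩
  have e : φ (x ^ k) - τ • v = (φ (x ^ k) - (k : ℝ) • φ x) + (k : ℝ) • (φ x - ‖φ x‖ • v)
      + (k * ‖φ x‖ - τ) • v := by
    rw [smul_sub, sub_smul, smul_smul]; abel
  rw [e]
  refine (norm_add₃_le).trans ?_
  rw [norm_smul, norm_smul, hv, Real.norm_natCast, Real.norm_eq_abs, abs_of_nonpos (by linarith)]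
  have q1 : (k : ℝ) * ‖φ x - ‖φ x‖ • v‖ ≤ k * (δ * ‖φ x‖) := by gcongr
  have q2 : δ * (k * ‖φ x‖) ≤ δ * τ := by gcongr
  have q3 : δ * τ ≤ ε / 3 * τ := by gcongr
  nlinarith

variable [FiniteDimensional ℝ E]

/-- Small elements of `H` are almost tangent to `H`: otherwise their directions would accumulate, by
compactness of the unit sphere, at a vector that is not tangent. -/
theorem sub_proj_le {P : E →L[ℝ] E} (hP : ∀ w ∈ hφ.tangentSpace H, P w = w) {ε : ℝ} (hε : 0 < ε) :
    ∃ r > 0, ∀ h ∈ H, h ∈ φ.source → ‖φ h‖ < r → ‖φ h - P (φ h)‖ ≤ ε * ‖φ h‖ := by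
  by_contra! hcon
  choose x hxH hxs hxr hx using fun n : ℕ => hcon (1 / (n + 1)) (by positivity)
  have hx0 : ∀ n, 0 < ‖φ (x n)‖ := fun n => by
    rcases (norm_nonneg (φ (x n))).eq_or_lt with h | h
    · have h' := norm_eq_zero.mp h.symm
      have := hx n
      simp [h'] at this
    · exact h
  obtain ⟨v, hv, f, hf, hlim⟩ := (isCompact_sphere (0 : E) 1).tendsto_subseq
    (x := fun n => ‖φ (x n)‖⁻¹ • φ (x n)) (fun n => by
      rw [mem_sphere_zero_iff_norm, norm_smul, norm_inv, norm_norm, inv_mul_cancel₀ (hx0 n).ne'])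
  rw [mem_sphere_zero_iff_norm] at hv
  have hvt : v ∈ hφ.tangentSpace H := by
    refine hφ.mem_tangentSpace_of_direction hv fun δ hδ r hr => ?_
    have h1 : ∀ᶠ n in atTop, dist (‖φ (x (f n))‖⁻¹ • φ (x (f n))) v < δ :=
      Metric.tendsto_nhds.mp hlim δ hδ
    have h2 : ∀ᶠ n in atTop, 1 / ((f n : ℝ) + 1) < r :=
      (tendsto_one_div_add_atTop_nhds_zero_nat.comp hf.tendsto_atTop).eventually_lt_const hr
    obtain ⟨n, hn1, hn2⟩ := (h1.and h2).exists
    refine ⟨x (f n), hxH _, hxs _, hx0 _, (hxr _).trans hn2, ?_⟩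
    rw [dist_eq_norm] at hn1
    have e : φ (x (f n)) - ‖φ (x (f n))‖ • v
        = ‖φ (x (f n))‖ • (‖φ (x (f n))‖⁻¹ • φ (x (f n)) - v) := by
      rw [smul_sub, smul_inv_smul₀ (hx0 _).ne']
    rw [e, norm_smul, norm_norm, mul_comm]
    gcongr
  have hge : ε ≤ ‖v - P v‖ := by
    have hl : Tendsto (fun n => ‖‖φ (x (f n))‖⁻¹ • φ (x (f n))
        - P (‖φ (x (f n))‖⁻¹ • φ (x (f n)))‖) atTop (𝓝 ‖v - P v‖) :=
      (hlim.sub ((P.continuous.tendsto v).comp hlim)).norm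
    refine ge_of_tendsto' hl fun n => ?_
    rw [map_smul, ← smul_sub, norm_smul, norm_inv, norm_norm, ← div_eq_inv_mul,
      le_div_iff₀ (hx0 _)]
    exact (hx _).le
  rw [hP v hvt, sub_self, norm_zero] at hge
  linarith

end IsAdditiveChart

end TangentSpace

/-! ### A slice transverse to a closed subgroup -/

section Slice

variable {E : Type*} [NormedAddCommGroup E] [NormedSpace ℝ E] [FiniteDimensional ℝ E]
  {G : Type*} [Group G] [TopologicalSpace G] [IsTopologicalGroup G]

namespace IsAdditiveChart

variable {φ : OpenPartialHomeomorph G E} (hφ : IsAdditiveChart φ) {H : Subgroup G}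

/-- Two points of the slice `P ∘ φ = 0` close to `1` that lie in the same coset of `H` are equal:
the element of `H` that carries one to the other is almost tangent to `H`, while the difference of
their coordinates lies in the kernel of `P`. -/
theorem eq_of_mul_inv_mem {P : E →L[ℝ] E} (hP : ∀ w ∈ hφ.tangentSpace H, P w = w) :
    ∃ r > 0, ∀ x ∈ φ.source, ∀ y ∈ φ.source, ‖φ x‖ < r → ‖φ y‖ < r → P (φ x) = 0 → P (φ y) = 0 →
      x * y⁻¹ ∈ H → x = y := by
  have hε : 0 < 1 / (4 * (1 + ‖P‖)) := by positivity
  set ε := 1 / (4 * (1 + ‖P‖)) with hεd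
  have hεP : ε * (1 + ‖P‖) = 1 / 4 := by rw [hεd]; field_simp
  obtain ⟨r₁, hr₁, hmul⟩ := hφ.mul_mem_and_approx hε
  obtain ⟨r₂, hr₂, htan⟩ := hφ.sub_proj_le hP hε
  have hU : {k | k ∈ φ.source ∧ ‖φ k‖ < min r₁ r₂} ∈ 𝓝 (1 : G) := by
    have hc : Tendsto (fun k => ‖φ k‖) (𝓝 1) (𝓝 0) := by
      have := (φ.continuousAt hφ.one_mem).norm.tendsto
      rwa [hφ.map_one, norm_zero] at this
    exact inter_mem hφ.source_mem (hc.eventually_lt_const (by positivity))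
  have hd : Tendsto (fun p : G × G => p.1 * p.2⁻¹) (𝓝 (1, 1)) (𝓝 1) := by
    have : Continuous (fun p : G × G => p.1 * p.2⁻¹) := by fun_prop
    simpa using this.tendsto (1, 1)
  have h := hd hU
  rw [nhds_prod_eq] at h
  obtain ⟨U, hU, V, hV, hUV⟩ := mem_prod_iff.mp h
  obtain ⟨r, hr, hrU⟩ :=
    OpenPartialHomeomorph.exists_radius_of_mem_nhds hφ.one_mem hφ.map_one (inter_mem hU hV)
  refine ⟨min r r₁, by positivity, fun x hx y hy hxr hyr hPx hPy hxy => ?_⟩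
  rw [lt_min_iff] at hxr hyr
  obtain ⟨ks, kr⟩ : x * y⁻¹ ∈ φ.source ∧ ‖φ (x * y⁻¹)‖ < min r₁ r₂ :=
    hUV (Set.mk_mem_prod (hrU x hx hxr.1).1 (hrU y hy hyr.1).2)
  rw [lt_min_iff] at kr
  set k := x * y⁻¹ with hk
  have hkx : k * y = x := by simp [hk]
  have e1 := (hmul k ks y hy kr.1 hyr.2).2
  rw [hkx] at e1
  have e2 := htan k hxy ks kr.2
  have e3 : ‖P (φ k)‖ ≤ ‖P‖ * (ε * ‖φ k‖) := by
    have : P (φ k) = -P (φ x - φ k - φ y) := by simp [hPx, hPy]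
    rw [this, norm_neg]
    exact (P.le_opNorm _).trans (by gcongr)
  have e4 : ‖φ k‖ ≤ ‖φ k - P (φ k)‖ + ‖P (φ k)‖ := by
    simpa using norm_add_le (φ k - P (φ k)) (P (φ k))
  -- neither the tangential nor the transverse part of `φ k` exceeds a quarter of `‖φ k‖`
  have e5 : ‖φ k‖ = 0 := by
    have : ‖φ k‖ ≤ ε * (1 + ‖P‖) * ‖φ k‖ := by linarith
    rw [hεP] at this
    have := norm_nonneg (φ k)
    linarith
  have e6 : k = 1 := φ.injOn ks hφ.one_mem (by rw [hφ.map_one, norm_eq_zero.mp e5])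
  rw [← hkx, e6, one_mul]

/-- Every coset of `H` through a point close to `1` meets the slice `P ∘ φ = 0`: otherwise
`‖P (φ (h * g))‖`, minimized over the small elements `h` of `H`, could be decreased further by an
element of `H` in a tangent direction. -/
theorem eventually_exists_mul_mem_slice [T2Space G] (hH : IsClosed (H : Set G)) {P : E →L[ℝ] E}
    (hP : ∀ w ∈ hφ.tangentSpace H, P w = w) (hP' : ∀ w, P w ∈ hφ.tangentSpace H)
    {ρ : ℝ} (hρ : 0 < ρ) :
    ∀ᶠ g in 𝓝 (1 : G), ∃ h ∈ H, h * g ∈ φ.source ∧ ‖φ (h * g)‖ ≤ ρ ∧ P (φ (h * g)) = 0 := by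
  set M := 1 + ‖P‖ with hM
  have hM1 : 1 ≤ M := by have := norm_nonneg P; linarith
  have hM0 : 0 < M := by linarith
  have hPM : ∀ w, ‖P w‖ ≤ M * ‖w‖ := fun w =>
    (P.le_opNorm w).trans (by gcongr; linarith)
  have hε : 0 < 1 / (8 * M) := by positivity
  set ε := 1 / (8 * M) with hεd
  have hεM : M * ε = 1 / 8 := by rw [hεd]; field_simp
  have hε1 : ε ≤ 1 / 8 := by nlinarith
  obtain ⟨r₁, hr₁, hmul⟩ := hφ.mul_mem_and_approx hε
  obtain ⟨r₂, hr₂, htan⟩ := hφ.sub_proj_le hP hε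
  obtain ⟨r₃, hr₃, htgt⟩ := Metric.mem_nhds_iff.mp
    (φ.open_target.mem_nhds (hφ.map_one ▸ φ.map_source hφ.one_mem : (0 : E) ∈ φ.target))
  have hR : 0 < min (min ρ r₁) (min r₂ r₃) / 4 := by positivity
  set R := min (min ρ r₁) (min r₂ r₃) / 4 with hRd
  have R0 : R * 4 ≤ ρ := by
    rw [hRd, div_mul_cancel₀ _ (by norm_num)]; exact (min_le_left _ _).trans (min_le_left _ _)
  have R1 : R * 4 ≤ r₁ := by
    rw [hRd, div_mul_cancel₀ _ (by norm_num)]; exact (min_le_left _ _).trans (min_le_right _ _)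
  have R2 : R * 4 ≤ r₂ := by
    rw [hRd, div_mul_cancel₀ _ (by norm_num)]; exact (min_le_right _ _).trans (min_le_left _ _)
  have R3 : R * 4 ≤ r₃ := by
    rw [hRd, div_mul_cancel₀ _ (by norm_num)]; exact (min_le_right _ _).trans (min_le_right _ _)
  set K : Set G := (φ.symm '' Metric.closedBall 0 R) ∩ H with hK
  have hball : Metric.closedBall (0 : E) R ⊆ φ.target :=
    (Metric.closedBall_subset_ball (by linarith)).trans htgt
  have hKc : IsCompact K := by
    refine IsCompact.inter_right ?_ hH
    exact (isCompact_closedBall 0 R).image_of_continuousOn (φ.continuousOn_symm.mono hball)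
  have memK : ∀ x, x ∈ K ↔ x ∈ φ.source ∧ ‖φ x‖ ≤ R ∧ x ∈ H := by
    intro x
    constructor
    · rintro ⟨⟨u, hu, rfl⟩, hx⟩
      refine ⟨φ.map_target (hball hu), ?_, hx⟩
      rw [φ.right_inv (hball hu)]
      simpa using hu
    · rintro ⟨h1, h2, h3⟩
      exact ⟨⟨φ x, by simpa using h2, φ.left_inv h1⟩, h3⟩
  have hδ : 0 < R / (8 * M) := by positivity
  set δ := R / (8 * M) with hδd
  have hδM : M * δ = R / 8 := by rw [hδd]; field_simp
  have hδR : δ ≤ R / 8 := by nlinarith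
  have hev : ∀ᶠ g in 𝓝 (1 : G), g ∈ φ.source ∧ ‖φ g‖ < δ := by
    have hc : Tendsto (fun k => ‖φ k‖) (𝓝 1) (𝓝 0) := by
      have := (φ.continuousAt hφ.one_mem).norm.tendsto
      rwa [hφ.map_one, norm_zero] at this
    exact inter_mem hφ.source_mem (hc.eventually_lt_const hδ)
  filter_upwards [hev] with g ⟨hg, hgδ⟩
  have hKg : ∀ x ∈ K, x * g ∈ φ.source ∧ ‖φ (x * g) - φ x - φ g‖ ≤ ε * ‖φ x‖ := fun x hx =>
    hmul x ((memK x).mp hx).1 g hg (by linarith [((memK x).mp hx).2.1]) (by linarith)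
  have hcont : ContinuousOn (fun x => ‖P (φ (x * g))‖) K := by
    have h1 : ContinuousOn (fun x => φ (x * g)) K :=
      φ.continuousOn.comp (continuous_mul_const g).continuousOn fun x hx => (hKg x hx).1
    exact (P.continuous.comp_continuousOn h1).norm
  have h1K : (1 : G) ∈ K := (memK 1).mpr ⟨hφ.one_mem, by simp [hφ.map_one, hR.le], H.one_mem⟩
  obtain ⟨h, hhK, hmin⟩ := hKc.exists_isMinOn ⟨1, h1K⟩ hcont
  obtain ⟨hs, hhR, hhH⟩ := (memK h).mp hhK
  obtain ⟨hgs, hge⟩ := hKg h hhK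
  -- the minimum is not attained on the boundary of the ball
  have hlt : ‖φ h‖ < R := by
    by_contra! hcon
    have heq : ‖φ h‖ = R := le_antisymm hhR hcon
    have m1 : ‖P (φ (h * g))‖ ≤ M * δ := by
      have : ‖P (φ (h * g))‖ ≤ ‖P (φ (1 * g))‖ := hmin h1K
      rw [one_mul] at this
      exact this.trans ((hPM _).trans (by gcongr))
    have m2 := htan h hhH hs (by linarith)
    have m3 : ‖φ h‖ ≤ ‖φ h - P (φ h)‖ + ‖P (φ (h * g))‖ + ‖P (φ (h * g) - φ h - φ g)‖
        + ‖P (φ g)‖ := by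
      have : φ h = (φ h - P (φ h)) + P (φ (h * g)) - P (φ (h * g) - φ h - φ g) - P (φ g) := by
        simp only [map_sub]; abel
      calc ‖φ h‖ = _ := congrArg norm this
        _ ≤ _ := (norm_sub_le _ _).trans (by
          gcongr; exact (norm_sub_le _ _).trans (by gcongr; exact norm_add_le _ _))
    have m4 := (hPM (φ (h * g) - φ h - φ g)).trans (mul_le_mul_of_nonneg_left hge hM0.le)
    have m5 := (hPM (φ g)).trans (mul_le_mul_of_nonneg_left hgδ.le hM0.le)
    rw [heq] at m2 m3 m4
    rw [← mul_assoc M, hεM] at m4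
    have : ε * R ≤ 1 / 8 * R := by gcongr
    linarith
  have hgn : ‖φ (h * g)‖ ≤ 3 * R := by
    have : φ (h * g) = (φ (h * g) - φ h - φ g) + φ h + φ g := by abel
    rw [this]
    refine (norm_add₃_le).trans ?_
    have : ε * ‖φ h‖ ≤ 1 / 8 * R := by gcongr
    linarith
  refine ⟨h, hhH, hgs, by linarith, ?_⟩
  by_contra hne
  -- an element `k` of `H` with `φ k ≈ -τ w` makes `‖P (φ (k * h * g))‖` about `(1 - τ) ‖w‖`
  set w := P (φ (h * g)) with hw
  have hw0 : 0 < ‖w‖ := norm_pos_iff.mpr hne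
  obtain ⟨τ₀, hτ₀, hτ⟩ := (hφ.mem_tangentSpace.mp
    ((hφ.tangentSpace H).neg_mem (hP' (φ (h * g))))) (ε * ‖w‖) (by positivity)
  obtain ⟨τ, hτpos, hτlt⟩ := exists_between
    (show (0 : ℝ) < min (min τ₀ 1) ((R - ‖φ h‖) / (4 * ‖w‖)) by
      have : 0 < R - ‖φ h‖ := by linarith
      positivity)
  simp only [lt_min_iff] at hτlt
  obtain ⟨⟨t1, t2⟩, t3⟩ := hτlt
  rw [lt_div_iff₀ (by positivity)] at t3
  obtain ⟨k, kH, ks, kb⟩ := hτ τ hτpos t1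
  rw [smul_neg, sub_neg_eq_add, ← hw] at kb
  have htw : 0 < τ * ‖w‖ := by positivity
  have kn : ‖φ k‖ ≤ 2 * (τ * ‖w‖) := by
    have e : φ k = (φ k + τ • w) - τ • w := by abel
    rw [e]
    refine (norm_sub_le _ _).trans ?_
    rw [norm_smul, Real.norm_of_nonneg hτpos.le]
    nlinarith
  obtain ⟨a1, a2⟩ := hmul k ks h hs (by linarith [norm_nonneg (φ h)]) (by linarith)
  have khK : k * h ∈ K := by
    refine (memK _).mpr ⟨a1, ?_, H.mul_mem kH hhH⟩
    have e : φ (k * h) = (φ (k * h) - φ k - φ h) + φ k + φ h := by abel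
    rw [e]
    refine (norm_add₃_le).trans ?_
    have : ε * ‖φ k‖ ≤ 1 * ‖φ k‖ := by gcongr; linarith
    linarith
  have hle : ‖w‖ ≤ ‖P (φ (k * h * g))‖ := hmin khK
  rw [mul_assoc] at hle
  obtain ⟨b1, b2⟩ := hmul k ks (h * g) hgs (by linarith [norm_nonneg (φ h)]) (by linarith)
  have e : P (φ (k * (h * g))) = P (φ (k * (h * g)) - φ k - φ (h * g)) + P (φ k + τ • w)
      + (1 - τ) • w := by
    simp only [map_sub, map_add, map_smul, hP w (hP' _), sub_smul, one_smul, ← hw]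
    abel
  rw [e] at hle
  have c1 := norm_add₃_le (a := P (φ (k * (h * g)) - φ k - φ (h * g))) (b := P (φ k + τ • w))
    (c := (1 - τ) • w)
  rw [norm_smul, Real.norm_of_nonneg (by linarith : 0 ≤ 1 - τ)] at c1
  have c2 := (hPM (φ (k * (h * g)) - φ k - φ (h * g))).trans
    (mul_le_mul_of_nonneg_left b2 hM0.le)
  have c3 := (hPM (φ k + τ • w)).trans (mul_le_mul_of_nonneg_left kb hM0.le)
  rw [← mul_assoc M, hεM] at c2
  have c4 : M * (ε * ‖w‖ * τ) = 1 / 8 * (τ * ‖w‖) := by rw [← hεM]; ring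
  rw [c4] at c3
  linarith

end IsAdditiveChart

/-- A closed subgroup `H` of a Lie group has a compact slice at `1`: a compact set that meets each
coset `H g` at most once, and exactly once for `g` close to `1`. -/
theorem LieGroup.exists_compact_slice {G : Type*} [Group G] [TopologicalSpace G] [T2Space G]
    [ChartedSpace E G] [LieGroup 𝓘(ℝ, E) ∞ G] {H : Subgroup G} (hH : IsClosed (H : Set G)) :
    ∃ B : Set G, IsCompact B ∧ (∀ x ∈ B, ∀ y ∈ B, x * y⁻¹ ∈ H → x = y) ∧
      ∀ᶠ g in 𝓝 (1 : G), ∃ h ∈ H, h * g ∈ B := by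
  have hG : IsTopologicalGroup G := topologicalGroup_of_lieGroup 𝓘(ℝ, E) ∞
  obtain ⟨φ, h1, h0, happ⟩ := LieGroup.exists_chart_mul_approx (E := E) (G := G)
  have hφ : IsAdditiveChart φ := ⟨h1, h0, happ⟩
  obtain ⟨f, hf⟩ := Submodule.ClosedComplemented.of_finiteDimensional (hφ.tangentSpace H)
  set P : E →L[ℝ] E := (hφ.tangentSpace H).subtypeL.comp f with hPd
  have hP : ∀ w ∈ hφ.tangentSpace H, P w = w := fun w hw => by
    simpa [hPd] using congrArg Subtype.val (hf ⟨w, hw⟩)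
  have hP' : ∀ w, P w ∈ hφ.tangentSpace H := fun w => (f w).2
  obtain ⟨r, hr, hinj⟩ := hφ.eq_of_mul_inv_mem hP
  obtain ⟨r₃, hr₃, htgt⟩ := Metric.mem_nhds_iff.mp
    (φ.open_target.mem_nhds (hφ.map_one ▸ φ.map_source hφ.one_mem : (0 : E) ∈ φ.target))
  have hρ : 0 < min r r₃ / 2 := by positivity
  have hρ1 : min r r₃ / 2 < r := by have := min_le_left r r₃; linarith
  have hρ2 : min r r₃ / 2 < r₃ := by have := min_le_right r r₃; linarith
  set ρ := min r r₃ / 2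
  have hball : Metric.closedBall (0 : E) ρ ∩ {v | P v = 0} ⊆ φ.target :=
    Set.inter_subset_left.trans ((Metric.closedBall_subset_ball hρ2).trans htgt)
  refine ⟨φ.symm '' (Metric.closedBall 0 ρ ∩ {v | P v = 0}), ?_, ?_, ?_⟩
  · exact ((isCompact_closedBall 0 ρ).inter_right
      (isClosed_eq P.continuous continuous_const)).image_of_continuousOn
      (φ.continuousOn_symm.mono hball)
  · rintro _ ⟨u, hu, rfl⟩ _ ⟨v, hv, rfl⟩ huv
    have hu' := mem_closedBall_zero_iff.mp hu.1
    have hv' := mem_closedBall_zero_iff.mp hv.1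
    refine hinj _ (φ.map_target (hball hu)) _ (φ.map_target (hball hv)) ?_ ?_ ?_ ?_ huv
    · rw [φ.right_inv (hball hu)]; linarith
    · rw [φ.right_inv (hball hv)]; linarith
    · rw [φ.right_inv (hball hu)]; exact hu.2
    · rw [φ.right_inv (hball hv)]; exact hv.2
  · filter_upwards [hφ.eventually_exists_mul_mem_slice hH hP hP' hρ] with g ⟨h, hh, hs, hle, h0⟩
    exact ⟨h, hh, φ (h * g), ⟨mem_closedBall_zero_iff.mpr hle, h0⟩, φ.left_inv hs⟩

end Slice

/-! ### Local sections of `G → H \ G` -/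

section Coset

variable {G : Type*} [Group G] {H : Subgroup G}

theorem CosetSpace.mk_eq_mk {x y : G} : CosetSpace.mk H x = CosetSpace.mk H y ↔ y * x⁻¹ ∈ H := by
  exact Quotient.eq.trans QuotientGroup.rightRel_apply

theorem CosetSpace.mk_surjective : Function.Surjective (CosetSpace.mk H) := Quotient.mk_surjective

theorem CosetSpace.mk_mul_of_mem {h : G} (hh : h ∈ H) (g : G) :
    CosetSpace.mk H (h * g) = CosetSpace.mk H g := by
  rw [CosetSpace.mk_eq_mk, mul_inv_rev, mul_inv_cancel_left]
  exact H.inv_mem hh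

variable [TopologicalSpace G] [IsTopologicalGroup G] [TopologicalSpace (CosetSpace H)]

theorem CosetSpace.isOpenMap_mk (hquot : IsQuotientMap (CosetSpace.mk H)) :
    IsOpenMap (CosetSpace.mk H) := by
  intro U hU
  rw [← hquot.isOpen_preimage]
  have : CosetSpace.mk H ⁻¹' (CosetSpace.mk H '' U) = ⋃ h : H, (fun x => (h : G) * x) ⁻¹' U := by
    ext x
    simp only [Set.mem_preimage, Set.mem_image, Set.mem_iUnion]
    constructor
    · rintro ⟨y, hy, hyx⟩
      refine ⟨⟨y * x⁻¹, CosetSpace.mk_eq_mk.mp hyx.symm⟩, by simpa using hy⟩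
    · rintro ⟨h, hh⟩
      exact ⟨_, hh, CosetSpace.mk_mul_of_mem h.2 x⟩
  rw [this]
  exact isOpen_iUnion fun h => hU.preimage (continuous_const_mul (h : G))

/-- A compact slice at `1` yields, by translation, local sections of `G → H \ G` everywhere. -/
theorem CosetSpace.exists_local_section [T2Space (CosetSpace H)]
    (hquot : IsQuotientMap (CosetSpace.mk H)) {B : Set G} (hB : IsCompact B)
    (hinj : ∀ x ∈ B, ∀ y ∈ B, x * y⁻¹ ∈ H → x = y) (hnhds : ∀ᶠ g in 𝓝 (1 : G), ∃ h ∈ H, h * g ∈ B)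
    (q : CosetSpace H) :
    ∃ N ∈ 𝓝 q, ∃ s : CosetSpace H → G, ContinuousOn s N ∧ ∀ p ∈ N, CosetSpace.mk H (s p) = p := by
  obtain ⟨g, rfl⟩ := CosetSpace.mk_surjective q
  have : CompactSpace B := isCompact_iff_compactSpace.mp hB
  set f : B → CosetSpace H := fun b => CosetSpace.mk H (b * g) with hf
  have hfc : Continuous f := by
    exact hquot.continuous.comp (continuous_subtype_val.mul_const g)
  have hfi : Function.Injective f := by
    intro x y hxy
    have := CosetSpace.mk_eq_mk.mp hxy
    rw [mul_inv_rev, mul_assoc, mul_inv_cancel_left] at this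
    exact (Subtype.ext (hinj _ y.2 _ x.2 this)).symm
  have hemb := hfc.isClosedEmbedding hfi
  have h1 : ∃ b, f b = CosetSpace.mk H g := by
    obtain ⟨h, hh, hb⟩ := hnhds.self_of_nhds
    refine ⟨⟨_, hb⟩, ?_⟩
    rw [mul_one] at hb
    simp [hf, CosetSpace.mk_mul_of_mem hh]
  have : Nonempty B := ⟨h1.choose⟩
  refine ⟨Set.range f, ?_, fun p => (Function.invFun f p : B) * g, ?_, ?_⟩
  · have ht : ∀ᶠ x in 𝓝 g, ∃ h ∈ H, h * (x * g⁻¹) ∈ B := by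
      have : Tendsto (fun x : G => x * g⁻¹) (𝓝 g) (𝓝 1) := by
        simpa using (continuous_mul_const g⁻¹).tendsto g
      exact this.eventually hnhds
    refine mem_of_superset ((CosetSpace.isOpenMap_mk hquot).image_mem_nhds ht) ?_
    rintro _ ⟨x, ⟨h, hh, hb⟩, rfl⟩
    refine ⟨⟨_, hb⟩, ?_⟩
    simp [hf, mul_assoc, CosetSpace.mk_mul_of_mem hh]
  · refine ContinuousOn.mul (continuous_subtype_val.comp_continuousOn ?_) continuousOn_const
    rw [continuousOn_iff_continuous_domRestrict,
      ← (hemb.isEmbedding.toHomeomorph).comp_continuous_iff']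
    convert continuous_id using 1
    funext b
    simp [Function.leftInverse_invFun hfi b]
  · rintro _ ⟨b, rfl⟩
    have := congrArg (fun b : B => CosetSpace.mk H (b * g)) (Function.leftInverse_invFun hfi b)
    exact this

end Coset

/-! ### Homotopy lifting -/

section Lifting

variable {A G : Type*} [TopologicalSpace A] [Group G] [TopologicalSpace G] [IsTopologicalGroup G]
  {H : Subgroup G} [TopologicalSpace (CosetSpace H)]

/-- If `p` has a lift and `p'` differs from `p` only where both take values in the domain of a
local section, then `p'` has a lift; there the given lift is an `H`-multiple of the
section, and it is continued as the same multiple. -/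
theorem CosetSpace.exists_lift_of_eqOn_compl {p p' : A → CosetSpace H} (hp : Continuous p)
    (hp' : Continuous p') {l : A → G} (hl : Continuous l) (hlp : ∀ a, CosetSpace.mk H (l a) = p a)
    {Z U : Set A} (hZ : IsClosed Z) (hU : IsOpen U) (hZU : Z ⊆ U) (heq : ∀ a ∉ Z, p' a = p a)
    {N : Set (CosetSpace H)} {s : CosetSpace H → G} (hs : ContinuousOn s N)
    (hsN : ∀ q ∈ N, CosetSpace.mk H (s q) = q) (hpN : ∀ a ∈ U, p a ∈ N) (hpN' : ∀ a ∈ U, p' a ∈ N) :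
    ∃ l' : A → G, Continuous l' ∧ (∀ a, CosetSpace.mk H (l' a) = p' a) ∧
      ∀ a, p' a = p a → l' a = l a := by
  classical
  set l' : A → G := fun a => if a ∈ U then l a * (s (p a))⁻¹ * s (p' a) else l a with hl'
  have hrel : ∀ a, p' a = p a → l' a = l a := by
    intro a ha
    by_cases haU : a ∈ U
    · simp [hl', haU, ha]
    · simp [hl', haU]
  refine ⟨l', ?_, fun a => ?_, hrel⟩
  · rw [continuous_iff_continuousAt]
    intro a
    by_cases haU : a ∈ U
    · have hUa := hU.mem_nhds haU
      have h1 : ContinuousAt (fun a => s (p a)) a :=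
        (hs.comp hp.continuousOn hpN).continuousAt hUa
      have h2 : ContinuousAt (fun a => s (p' a)) a :=
        (hs.comp hp'.continuousOn hpN').continuousAt hUa
      refine ((hl.continuousAt.mul h1.inv).mul h2).congr ?_
      filter_upwards [hUa] with b hb
      simp [hl', hb]
    · refine hl.continuousAt.congr ?_
      filter_upwards [hZ.isOpen_compl.mem_nhds fun h => haU (hZU h)] with b hb
      exact (hrel b (heq b hb)).symm
  · by_cases haU : a ∈ U
    · have h1 : CosetSpace.mk H (s (p a)) = CosetSpace.mk H (l a) := by
        rw [hsN _ (hpN a haU), hlp]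
      simp only [hl', haU, if_true]
      rw [CosetSpace.mk_mul_of_mem (CosetSpace.mk_eq_mk.mp h1), hsN _ (hpN' a haU)]
    · rw [hrel a (heq a fun h => haU (hZU h)), hlp, heq a fun h => haU (hZU h)]

end Lifting

section Homotopy

variable {A G : Type*} [MetricSpace A] [CompactSpace A] [Group G] [TopologicalSpace G]
  [IsTopologicalGroup G] {H : Subgroup G} [TopologicalSpace (CosetSpace H)]

/-- Regular homotopy lifting: the end of the lifted homotopy agrees with its beginning wherever the
given homotopy is stationary. -/
theorem CosetSpace.exists_lift_of_homotopy
    (hsec : ∀ q : CosetSpace H, ∃ N ∈ 𝓝 q, ∃ s : CosetSpace H → G,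
      ContinuousOn s N ∧ ∀ p ∈ N, CosetSpace.mk H (s p) = p)
    {h : A × ℝ → CosetSpace H} (hh : Continuous h) {l : A → G} (hl : Continuous l)
    (hl0 : ∀ a, CosetSpace.mk H (l a) = h (a, 0)) :
    ∃ l' : A → G, Continuous l' ∧ (∀ a, CosetSpace.mk H (l' a) = h (a, 1)) ∧
      ∀ a, (∀ t ∈ Set.Icc (0 : ℝ) 1, h (a, t) = h (a, 0)) → l' a = l a := by
  choose N hN s hsc hs using hsec
  obtain ⟨δ, hδ, hleb⟩ := lebesgue_number_lemma_of_metric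
    (s := (Set.univ : Set A) ×ˢ Set.Icc (0 : ℝ) 1) (c := fun q => h ⁻¹' interior (N q))
    (isCompact_univ.prod isCompact_Icc) (fun q => isOpen_interior.preimage hh)
    (fun x _ => Set.mem_iUnion.mpr ⟨h x, mem_interior_iff_mem_nhds.mpr (hN (h x))⟩)
  obtain ⟨m, hm⟩ := exists_nat_one_div_lt hδ
  have hm0 : (0 : ℝ) < m + 1 := by positivity
  -- the homotopy is followed up to a time that depends on the point
  let Liftable : (A → ℝ) → Prop := fun τ => ∃ l' : A → G, Continuous l' ∧
    (∀ a, CosetSpace.mk H (l' a) = h (a, τ a)) ∧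
      ∀ a, (∀ t ∈ Set.Icc (0 : ℝ) 1, h (a, t) = h (a, 0)) → l' a = l a
  have step : ∀ j : ℕ, j < m + 1 → Liftable (fun _ => j / (m + 1)) →
      Liftable (fun _ => (j + 1 : ℕ) / (m + 1)) := by
    intro j hj hjl
    obtain ⟨F, -, hF⟩ := (isCompact_univ (X := A)).elim_nhds_subcover
      (fun c => Metric.ball c (δ / 2)) (fun c _ => Metric.ball_mem_nhds c (by positivity))
    let ρ : A → A → ℝ := fun c a => max 0 (min 1 (3 - 4 * dist a c / δ))
    have hρc : ∀ c, Continuous (ρ c) := fun c => by fun_prop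
    have hρ0 : ∀ c a, 0 ≤ ρ c a := fun c a => le_max_left _ _
    have hρ1 : ∀ c a, ρ c a ≤ 1 := fun c a => max_le zero_le_one (min_le_left _ _)
    have hρball : ∀ c a, dist a c < δ / 2 → ρ c a = 1 := fun c a h => by
      have : 4 * dist a c / δ ≤ 2 := by rw [div_le_iff₀ hδ]; linarith
      simp only [ρ]
      rw [min_eq_left (by linarith), max_eq_right zero_le_one]
    have hρout : ∀ c a, 3 * δ / 4 < dist a c → ρ c a = 0 := fun c a h => by
      have : 3 ≤ 4 * dist a c / δ := by rw [le_div_iff₀ hδ]; linarith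
      simp only [ρ]
      exact max_eq_left ((min_le_right _ _).trans (by linarith))
    let π : Finset A → A → ℝ := fun S a => ∏ c ∈ S, (1 - ρ c a)
    have hπc : ∀ S, Continuous (π S) := fun S =>
      continuous_finsetProd _ fun c _ => continuous_const.sub (hρc c)
    have hπ0 : ∀ S a, 0 ≤ π S a := fun S a =>
      Finset.prod_nonneg fun c _ => by linarith [hρ1 c a]
    have hπ1 : ∀ S a, π S a ≤ 1 := fun S a =>
      Finset.prod_le_one (fun c _ => by linarith [hρ1 c a]) fun c _ => by linarith [hρ0 c a]
    let σ : Finset A → A → ℝ := fun S a => (j + (1 - π S a)) / (m + 1)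
    have hσc : ∀ S, Continuous (σ S) := fun S =>
      (continuous_const.add (continuous_const.sub (hπc S))).div_const _
    have hj1 : (j : ℝ) + 1 ≤ m + 1 := by exact_mod_cast hj
    have hjI : (j / (m + 1) : ℝ) ∈ Set.Icc (0 : ℝ) 1 :=
      ⟨by positivity, by rw [div_le_one hm0]; linarith⟩
    have hσI : ∀ S a, σ S a ∈ Set.Icc (0 : ℝ) 1 := fun S a => by
      refine ⟨div_nonneg (by linarith [hπ1 S a, (Nat.cast_nonneg j : (0 : ℝ) ≤ j)]) hm0.le, ?_⟩
      rw [div_le_one hm0]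
      linarith [hπ0 S a]
    have hσd : ∀ S a, dist (σ S a) (j / (m + 1)) < δ := fun S a => by
      have : σ S a - j / (m + 1) = (1 - π S a) / (m + 1) := by simp only [σ]; ring
      rw [Real.dist_eq, this, abs_of_nonneg (div_nonneg (by linarith [hπ1 S a]) hm0.le)]
      refine lt_of_le_of_lt ?_ hm
      gcongr
      linarith [hπ0 S a]
    -- the points are moved on from time `j / (m + 1)` ball by ball; `σ S` is the time function after
    -- the balls with centres in `S` have been treated
    have key : ∀ S : Finset A, Liftable (σ S) := by
      intro S
      induction S using Finset.cons_induction with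
      | empty => simpa [σ, π] using hjl
      | cons c S hc ih =>
        obtain ⟨l₁, hl₁, hl₁h, hl₁r⟩ := ih
        obtain ⟨q, hq⟩ := hleb (c, j / (m + 1)) ⟨Set.mem_univ _, hjI⟩
        have hin : ∀ S, ∀ a ∈ Metric.ball c δ, h (a, σ S a) ∈ N q := fun S a ha => by
          refine interior_subset (hq (?_ : (a, σ S a) ∈ Metric.ball _ _))
          rw [Metric.mem_ball, Prod.dist_eq]
          exact max_lt ha (hσd S a)
        obtain ⟨l₂, hl₂, hl₂h, hl₂r⟩ := CosetSpace.exists_lift_of_eqOn_compl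
          (p := fun a => h (a, σ S a)) (p' := fun a => h (a, σ (Finset.cons c S hc) a))
          (hh.comp (continuous_id.prodMk (hσc _))) (hh.comp (continuous_id.prodMk (hσc _)))
          hl₁ hl₁h (Metric.isClosed_closedBall (x := c) (ε := 3 * δ / 4)) Metric.isOpen_ball
          (Metric.closedBall_subset_ball (by linarith)) (fun a ha => by
            have : ρ c a = 0 := hρout c a (by simpa using ha)
            simp [σ, π, this]) (hsc q) (hs q) (hin S) (hin _)
        refine ⟨l₂, hl₂, hl₂h, fun a ha => ?_⟩
        rw [hl₂r a (by simp only [ha _ (hσI _ a)]), hl₁r a ha]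
    have hfull : σ F = fun _ => ((j + 1 : ℕ) : ℝ) / (m + 1) := by
      funext a
      obtain ⟨c, hcF, hac⟩ := Set.mem_iUnion₂.mp (hF (Set.mem_univ a))
      have : π F a = 0 := Finset.prod_eq_zero hcF (by rw [hρball c a hac, sub_self])
      simp [σ, this]
    rw [← hfull]
    exact key F
  have all : ∀ j : ℕ, j ≤ m + 1 → Liftable (fun _ => j / (m + 1)) := by
    intro j
    induction j with
    | zero => exact fun _ => ⟨l, hl, by simpa using hl0, fun _ _ => rfl⟩
    | succ j ih => exact fun hj => step j hj (ih (by omega))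
  have := all (m + 1) le_rfl
  have e : ((m + 1 : ℕ) : ℝ) / (m + 1) = 1 := by push_cast; exact div_self hm0.ne'
  rwa [e] at this

end Homotopy

/-! ### Lifting maps from an open cone -/

namespace AbstractSimplicialComplex

variable {V : Type*}

section Cone

variable {L : AbstractSimplicialComplex V}

theorem Cone.nonneg (x : L.Cone) (v : V) : 0 ≤ x.1 v := by
  rcases x.2 with h | h
  · simp [h]
  · exact h.1 v

/-- The apex of the cone. -/
def Cone.apex : L.Cone := ⟨0, Or.inl rfl⟩

/-- Scaling of the cone by a real number, negative numbers being treated as `0`. -/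
def Cone.scale (c : ℝ) (x : L.Cone) : L.Cone := ⟨max c 0 • x.1, by
  rcases x.2 with h | ⟨h1, σ, hσ, h2⟩
  · exact Or.inl (by rw [h, smul_zero])
  · refine Or.inr ⟨fun v => mul_nonneg (le_max_right _ _) (h1 v), σ, hσ, fun v hv => ?_⟩
    simp [h2 v hv]⟩

theorem Cone.continuous_scale : Continuous (fun p : ℝ × L.Cone => Cone.scale p.1 p.2) :=
  Continuous.subtype_mk ((continuous_fst.max continuous_const).smul
    (continuous_subtype_val.comp continuous_snd)) _

theorem Cone.scale_one (x : L.Cone) : Cone.scale 1 x = x := by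
  apply Subtype.ext; simp [Cone.scale]

theorem Cone.scale_zero (x : L.Cone) : Cone.scale 0 x = Cone.apex := by
  apply Subtype.ext; simp [Cone.scale, Cone.apex]

variable [Fintype V]

variable (L) in
theorem isClosed_cone : IsClosed
    {x : V → ℝ | x = 0 ∨ (∀ v, 0 ≤ x v) ∧ ∃ σ ∈ L, ∀ v, v ∉ σ → x v = 0} := by
  have : {x : V → ℝ | x = 0 ∨ (∀ v, 0 ≤ x v) ∧ ∃ σ ∈ L, ∀ v, v ∉ σ → x v = 0} =
      {0} ∪ ({x | ∀ v, 0 ≤ x v} ∩ ⋃ σ ∈ {σ : Finset V | σ ∈ L}, {x | ∀ v, v ∉ σ → x v = 0}) := by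
    ext x; simp
  rw [this]
  refine isClosed_singleton.union (IsClosed.inter ?_ (Set.Finite.isClosed_biUnion (Set.toFinite _)
    fun σ _ => ?_))
  · simp only [Set.ofPred_forall]
    exact isClosed_iInter fun v => isClosed_le continuous_const (continuous_apply v)
  · simp only [Set.ofPred_forall]
    exact isClosed_iInter fun v => isClosed_iInter fun _ =>
      isClosed_eq (continuous_apply v) continuous_const

theorem Cone.isCompact_norm_le (R : ℝ) : IsCompact {x : L.Cone | ‖x.1‖ ≤ R} := by
  have h : IsCompact (Metric.closedBall (0 : V → ℝ) R) := isCompact_closedBall 0 R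
  have e : {x : L.Cone | ‖x.1‖ ≤ R} = Subtype.val ⁻¹' Metric.closedBall (0 : V → ℝ) R := by
    ext x; simp
  rw [e]
  exact L.isClosed_cone.isClosedEmbedding_subtypeVal.isCompact_preimage h

/-- The radial retraction of the cone onto the points of norm at most `R`. -/
noncomputable def Cone.retract (R : ℝ) (x : L.Cone) : L.Cone := Cone.scale (R / max R ‖x.1‖) x

theorem Cone.continuous_retract {R : ℝ} (hR : 0 < R) :
    Continuous (Cone.retract R : L.Cone → L.Cone) := by
  have h : Continuous (fun x : L.Cone => R / max R ‖x.1‖) :=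
    continuous_const.div (continuous_const.max continuous_subtype_val.norm)
      fun x => (lt_max_of_lt_left hR).ne'
  exact Cone.continuous_scale.comp (h.prodMk continuous_id)

theorem Cone.norm_retract_le {R : ℝ} (hR : 0 < R) (x : L.Cone) : ‖(Cone.retract R x).1‖ ≤ R := by
  have hm : 0 < max R ‖x.1‖ := lt_max_of_lt_left hR
  have h : 0 ≤ R / max R ‖x.1‖ := by positivity
  simp only [Cone.retract, Cone.scale]
  rw [norm_smul, max_eq_left h, Real.norm_of_nonneg h, div_mul_eq_mul_div, div_le_iff₀ hm]
  gcongr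
  exact le_max_right _ _

theorem Cone.div_max_norm {R : ℝ} (hR : 0 < R) {x : L.Cone} (hx : ‖x.1‖ ≤ R) :
    R / max R ‖x.1‖ = 1 := by
  rw [max_eq_left hx, div_self hR.ne']

theorem Cone.retract_eq {R : ℝ} (hR : 0 < R) {x : L.Cone} (hx : ‖x.1‖ ≤ R) :
    Cone.retract R x = x := by
  rw [Cone.retract, Cone.div_max_norm hR hx, Cone.scale_one]

end Cone

section Lift

variable [Fintype V] {L : AbstractSimplicialComplex V} {G : Type*} [Group G] [TopologicalSpace G]
  [IsTopologicalGroup G] {H : Subgroup G} [TopologicalSpace (CosetSpace H)]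
  (hsec : ∀ q : CosetSpace H, ∃ N ∈ 𝓝 q, ∃ s : CosetSpace H → G,
      ContinuousOn s N ∧ ∀ p ∈ N, CosetSpace.mk H (s p) = p)
  {β : L.Cone → CosetSpace H} (hβ : Continuous β)
include hsec hβ

/-- The homotopy from `x ↦ f x • x` to the identity is lifted over the ball of radius `R`; it is
stationary where `f = 1`. -/
theorem Cone.exists_lift_retract {f : L.Cone → ℝ} (hf : Continuous f) {l : L.Cone → G}
    (hl : Continuous l) (hlβ : ∀ x, CosetSpace.mk H (l x) = β (Cone.scale (f x) x))
    {R : ℝ} (hR : 0 < R) :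
    ∃ l' : L.Cone → G, Continuous l' ∧ (∀ x, CosetSpace.mk H (l' x) = β (Cone.retract R x)) ∧
      ∀ x, ‖x.1‖ ≤ R → f x = 1 → l' x = l x := by
  set A := {x : L.Cone | ‖x.1‖ ≤ R}
  have : CompactSpace A := isCompact_iff_compactSpace.mp (Cone.isCompact_norm_le R)
  have hh : Continuous (fun p : A × ℝ => β (Cone.scale ((1 - p.2) * f p.1 + p.2) p.1.1)) := by
    refine hβ.comp (Cone.continuous_scale.comp (Continuous.prodMk ?_ ?_))
    · have : Continuous (fun p : A × ℝ => f p.1.1) :=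
        hf.comp (continuous_subtype_val.comp continuous_fst)
      exact ((continuous_const.sub continuous_snd).mul this).add continuous_snd
    · exact continuous_subtype_val.comp continuous_fst
  obtain ⟨l₁, hl₁, hl₁h, hl₁r⟩ := CosetSpace.exists_lift_of_homotopy hsec hh
    (l := fun a => l a.1) (hl.comp continuous_subtype_val) (fun a => by simp [hlβ])
  refine ⟨fun x => l₁ ⟨Cone.retract R x, Cone.norm_retract_le hR x⟩,
    hl₁.comp ((Cone.continuous_retract hR).subtype_mk _), fun x => ?_, fun x hx hfx => ?_⟩
  · rw [hl₁h]
    simp [Cone.scale_one]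
  · have e : (⟨Cone.retract R x, Cone.norm_retract_le hR x⟩ : A) = ⟨x, hx⟩ :=
      Subtype.ext (Cone.retract_eq hR hx)
    refine (congrArg l₁ e).trans ?_
    exact hl₁r ⟨x, hx⟩ fun t _ => by simp [hfx]

/-- A map from an open cone to `H \ G` lifts to `G`. The lift is built over larger and larger
compact parts of the cone, each lift being left unchanged by the following ones. -/
theorem Cone.exists_lift : ∃ s : L.Cone → G, Continuous s ∧ ∀ x, CosetSpace.mk H (s x) = β x := by
  let S : ℕ → Type _ := fun n => {l : L.Cone → G //
    Continuous l ∧ ∀ x, CosetSpace.mk H (l x) = β (Cone.retract (n + 1) x)}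
  obtain ⟨g, hg⟩ := CosetSpace.mk_surjective (β Cone.apex)
  obtain ⟨l₀, hl₀, hl₀β, -⟩ := Cone.exists_lift_retract hsec hβ (f := fun _ => 0) continuous_const
    (l := fun _ => g) continuous_const (fun x => by rw [Cone.scale_zero, hg])
    (R := ((0 : ℕ) : ℝ) + 1) (by positivity)
  have hstep : ∀ n : ℕ, ∀ l : S n, ∃ l' : S (n + 1), ∀ x, ‖x.1‖ ≤ n + 1 → l'.1 x = l.1 x := by
    rintro n ⟨l, hl, hlβ⟩
    have hn : (0 : ℝ) < n + 1 := by positivity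
    obtain ⟨l', h1, h2, h3⟩ := Cone.exists_lift_retract hsec hβ
      (f := fun x => ((n : ℝ) + 1) / max ((n : ℝ) + 1) ‖x.1‖)
      (continuous_const.div (continuous_const.max continuous_subtype_val.norm)
        fun x => (lt_max_of_lt_left hn).ne') hl hlβ (R := ((n + 1 : ℕ) : ℝ) + 1) (by positivity)
    refine ⟨⟨l', h1, h2⟩, fun x hx => h3 x ?_ (Cone.div_max_norm hn hx)⟩
    push_cast
    linarith
  choose next hnext using hstep
  let l : ∀ n, S n := fun n => Nat.rec ⟨l₀, hl₀, hl₀β⟩ next n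
  have hl : ∀ n m : ℕ, n ≤ m → ∀ x : L.Cone, ‖x.1‖ ≤ n + 1 → (l m).1 x = (l n).1 x := by
    intro n m hnm x hx
    induction m, hnm using Nat.le_induction with
    | base => rfl
    | succ m hnm ih =>
      rw [← ih]
      refine hnext m (l m) x (hx.trans ?_)
      have : (n : ℝ) ≤ m := by exact_mod_cast hnm
      linarith
  refine ⟨fun x => (l ⌈‖x.1‖⌉₊).1 x, ?_, fun x => ?_⟩
  · rw [continuous_iff_continuousAt]
    intro x₀
    refine ((l ⌈‖x₀.1‖ + 1⌉₊).2.1.continuousAt (x := x₀)).congr ?_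
    have : ∀ᶠ x : L.Cone in 𝓝 x₀, ‖x.1‖ < ‖x₀.1‖ + 1 :=
      (continuous_subtype_val.norm.tendsto x₀).eventually_lt_const (lt_add_one _)
    filter_upwards [this] with x hx
    exact hl _ _ (Nat.ceil_mono hx.le) x ((Nat.le_ceil _).trans (by linarith))
  · rw [(l _).2.2, Cone.retract_eq (by positivity) ((Nat.le_ceil _).trans (by linarith))]

end Lift

end AbstractSimplicialComplex

/-! ### Proper expanding maps and the join -/

namespace AbstractSimplicialComplex

section Expanding

variable {V : Type*} [Fintype V] {L : AbstractSimplicialComplex V} {X : Type*} [MetricSpace X]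

theorem Cone.norm_le_sum (x : L.Cone) : ‖x.1‖ ≤ ∑ v, x.1 v := by
  refine (pi_norm_le_iff_of_nonneg (Finset.sum_nonneg fun v _ => x.nonneg v)).mpr fun v => ?_
  rw [Real.norm_of_nonneg (x.nonneg v)]
  exact Finset.single_le_sum (fun v _ => x.nonneg v) (Finset.mem_univ v)

theorem Cone.sum_le_card_mul_norm (x : L.Cone) : ∑ v, x.1 v ≤ Fintype.card V * ‖x.1‖ := by
  have : ∑ v, x.1 v ≤ ∑ _v : V, ‖x.1‖ := Finset.sum_le_sum fun v _ =>
    (le_abs_self _).trans (norm_le_pi_norm x.1 v)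
  simpa using this

theorem exists_norm_le_of_isProperMap [ProperSpace X] {f : L.Cone → X} (hf : IsProperMap f)
    (R D : ℝ) : ∃ R', ∀ x y : L.Cone, ‖x.1‖ ≤ R → dist (f x) (f y) ≤ D → ‖y.1‖ ≤ R' := by
  obtain ⟨M, hM⟩ := (((Cone.isCompact_norm_le (L := L) R).image
    hf.continuous).isBounded).subset_closedBall (f Cone.apex)
  have hc : IsCompact (f ⁻¹' Metric.closedBall (f Cone.apex) (D + M)) :=
    hf.isCompact_preimage (isCompact_closedBall _ _)
  obtain ⟨R', hR'⟩ := hc.exists_bound_of_continuousOn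
    (f := fun x : L.Cone => x.1) continuous_subtype_val.continuousOn
  refine ⟨R', fun x y hx hxy => hR' y ?_⟩
  have h1 := hM ⟨x, hx, rfl⟩
  rw [Metric.mem_closedBall] at h1
  rw [Set.mem_preimage, Metric.mem_closedBall]
  rw [dist_comm] at hxy
  linarith [dist_triangle (f y) (f x) (f Cone.apex)]

/-- For a proper expanding map, points over disjoint simplices whose images are at bounded distance
are bounded. The empty set of vertices, which spans the apex, is allowed as a simplex. -/
theorem exists_norm_le_of_isProperExpanding [ProperSpace X] {f : L.Cone → X}
    (hf : IsProperExpanding f) {σ τ : Finset V} (hσ : σ = ∅ ∨ σ ∈ L) (hτ : τ = ∅ ∨ τ ∈ L)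
    (hστ : Disjoint σ τ) (D : ℝ) : ∃ R, ∀ x y : L.Cone, (∀ v, v ∉ σ → x.1 v = 0) →
      (∀ v, v ∉ τ → y.1 v = 0) → dist (f x) (f y) ≤ D → ‖x.1‖ ≤ R ∧ ‖y.1‖ ≤ R := by
  -- it suffices to bound one of the two points
  suffices h : ∃ R, ∀ x y : L.Cone, (∀ v, v ∉ σ → x.1 v = 0) → (∀ v, v ∉ τ → y.1 v = 0) →
      dist (f x) (f y) ≤ D → ‖x.1‖ ≤ R ∨ ‖y.1‖ ≤ R by
    obtain ⟨R, hR⟩ := h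
    obtain ⟨R', hR'⟩ := exists_norm_le_of_isProperMap hf.1 R D
    refine ⟨max R R', fun x y hx hy hxy => ?_⟩
    rcases hR x y hx hy hxy with h | h
    · exact ⟨h.trans (le_max_left _ _), (hR' x y h hxy).trans (le_max_right _ _)⟩
    · exact ⟨(hR' y x h (by rwa [dist_comm])).trans (le_max_right _ _), h.trans (le_max_left _ _)⟩
  rcases hσ with rfl | hσ
  · refine ⟨0, fun x y hx _ _ => Or.inl ?_⟩
    have : x.1 = 0 := funext fun v => hx v (Finset.notMem_empty v)
    simp [this]
  rcases hτ with rfl | hτ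
  · refine ⟨0, fun x y _ hy _ => Or.inr ?_⟩
    have : y.1 = 0 := funext fun v => hy v (Finset.notMem_empty v)
    simp [this]
  obtain ⟨t, ht⟩ := ((hf.2 σ hσ τ hτ hστ).eventually
    (lt_mem_nhds (ENNReal.ofReal_lt_top (r := D)))).exists
  refine ⟨t, fun x y hx hy hxy => ?_⟩
  by_contra! hcon
  refine absurd ht (not_lt.mpr ?_)
  have h1 : f x ∈ f '' L.coneFrom σ t := ⟨x, ⟨hx, hcon.1.le.trans x.norm_le_sum⟩, rfl⟩
  have h2 : f y ∈ f '' L.coneFrom τ t := ⟨y, ⟨hy, hcon.2.le.trans y.norm_le_sum⟩, rfl⟩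
  refine (iInf₂_le_of_le _ h1 (iInf₂_le _ h2)).trans ?_
  rw [edist_dist]
  exact ENNReal.ofReal_le_ofReal hxy

/-- It is enough to bound points over disjoint simplices whose images are at bounded distance. -/
theorem isProperExpanding_of_exists_norm_le {f : L.Cone → X} (hf : IsProperMap f)
    (h : ∀ σ ∈ L, ∀ τ ∈ L, Disjoint σ τ → ∀ D : ℝ, ∃ R, ∀ x y : L.Cone,
      (∀ v, v ∉ σ → x.1 v = 0) → (∀ v, v ∉ τ → y.1 v = 0) → dist (f x) (f y) ≤ D → ‖x.1‖ ≤ R) :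
    IsProperExpanding f := by
  refine ⟨hf, fun σ hσ τ hτ hστ => ?_⟩
  rw [ENNReal.tendsto_nhds_top_iff_nnreal]
  intro D
  obtain ⟨R, hR⟩ := h σ hσ τ hτ hστ (D + 1)
  filter_upwards [eventually_gt_atTop (Fintype.card V * R)] with t ht
  refine lt_of_lt_of_le (b := ENNReal.ofReal (D + 1)) ?_ ?_
  · rw [← ENNReal.ofReal_coe_nnreal, ENNReal.ofReal_lt_ofReal_iff (by positivity)]
    exact lt_add_one _
  · refine le_iInf₂ ?_
    rintro _ ⟨x, ⟨hx, hxt⟩, rfl⟩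
    refine le_iInf₂ ?_
    rintro _ ⟨y, ⟨hy, -⟩, rfl⟩
    rw [edist_dist]
    refine ENNReal.ofReal_le_ofReal ?_
    by_contra! hcon
    have h1 := hR x y hx hy hcon.le
    have h2 := x.sum_le_card_mul_norm
    have : (Fintype.card V : ℝ) * ‖x.1‖ ≤ Fintype.card V * R := by gcongr
    linarith

end Expanding

section Join

variable {V W : Type*} {K : AbstractSimplicialComplex V} {L : AbstractSimplicialComplex W}

/-- The projection `cone(K * L) → cone(K)`; together with the other projection it identifies
`cone(K * L)` with `cone(K) × cone(L)`. -/
def Cone.left (x : (K.join L).Cone) : K.Cone :=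
  ⟨fun v => x.1 (Sum.inl v), by
    rcases x.2 with h | ⟨h, s, ⟨_, hs, _⟩, h0⟩
    · exact Or.inl (by rw [h]; rfl)
    · rcases hs with hs | hs
      · refine Or.inl (funext fun v => h0 _ fun hv => ?_)
        have := Finset.mem_toLeft.mpr hv
        simp [hs] at this
      · exact Or.inr ⟨fun v => h _, _, hs, fun v hv => h0 _ fun hv' => hv (by simpa using hv')⟩⟩

/-- The projection `cone(K * L) → cone(L)`. -/
def Cone.right (x : (K.join L).Cone) : L.Cone :=
  ⟨fun w => x.1 (Sum.inr w), by
    rcases x.2 with h | ⟨h, s, ⟨_, _, hs⟩, h0⟩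
    · exact Or.inl (by rw [h]; rfl)
    · rcases hs with hs | hs
      · refine Or.inl (funext fun v => h0 _ fun hv => ?_)
        have := Finset.mem_toRight.mpr hv
        simp [hs] at this
      · exact Or.inr ⟨fun v => h _, _, hs, fun v hv => h0 _ fun hv' => hv (by simpa using hv')⟩⟩

theorem Cone.continuous_left : Continuous (Cone.left : (K.join L).Cone → K.Cone) :=
  continuous_induced_rng.mpr (continuous_pi fun v =>
    (continuous_apply (Sum.inl v)).comp continuous_subtype_val)

theorem Cone.continuous_right : Continuous (Cone.right : (K.join L).Cone → L.Cone) :=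
  continuous_induced_rng.mpr (continuous_pi fun w =>
    (continuous_apply (Sum.inr w)).comp continuous_subtype_val)

variable [Fintype V] [Fintype W]

theorem Cone.norm_le_max (x : (K.join L).Cone) : ‖x.1‖ ≤ max ‖x.left.1‖ ‖x.right.1‖ := by
  refine (pi_norm_le_iff_of_nonneg (le_max_of_le_left (norm_nonneg _))).mpr ?_
  rintro (v | w)
  · exact (norm_le_pi_norm x.left.1 v).trans (le_max_left _ _)
  · exact (norm_le_pi_norm x.right.1 w).trans (le_max_right _ _)

end Join

section Product

variable {V W : Type*} [Fintype V] [Fintype W] {K : AbstractSimplicialComplex V}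
  {L : AbstractSimplicialComplex W} {G : Type*} [Group G] [MetricSpace G] [ProperSpace G]
  [IsTopologicalGroup G] {H : Subgroup G} [MetricSpace (CosetSpace H)] [ProperSpace (CosetSpace H)]

/-- The product of a proper expanding map to `H` and a lift of a proper expanding map to `H \ G`
is proper expanding. If two values over disjoint simplices of the join are close, the projection to
`H \ G` first bounds the coordinates in `cone(L)`; then `s` takes values in a compact set, and by
left invariance the values of `α` are close as well. -/
theorem isProperExpanding_mul_lift (hleft : ∀ g x y : G, dist (g * x) (g * y) = dist x y)
    (hH : IsClosed (H : Set G)) {C : ℝ≥0} (hC : LipschitzWith C (CosetSpace.mk H))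
    {α : K.Cone → H} (hα : IsProperExpanding α) {β : L.Cone → CosetSpace H}
    (hβ : IsProperExpanding β) {s : L.Cone → G} (hs : Continuous s)
    (hsβ : ∀ y, CosetSpace.mk H (s y) = β y) :
    IsProperExpanding (fun x : (K.join L).Cone => (α x.left : G) * s x.right) := by
  have hHp : ProperSpace H := .of_isClosed hH
  have hFβ : ∀ x : (K.join L).Cone,
      CosetSpace.mk H ((α x.left : G) * s x.right) = β x.right := fun x => by
    rw [CosetSpace.mk_mul_of_mem (α x.left).2, hsβ]
  set F : (K.join L).Cone → G := fun x => (α x.left : G) * s x.right with hF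
  have hFc : Continuous F :=
    (continuous_subtype_val.comp (hα.1.continuous.comp Cone.continuous_left)).mul
      (hs.comp Cone.continuous_right)
  refine isProperExpanding_of_exists_norm_le ?_ ?_
  · refine isProperMap_iff_isCompact_preimage.mpr ⟨hFc, fun S hS => ?_⟩
    -- first the coordinate in `cone(L)` is bounded, by projecting to `H \ G`, and then the one in
    -- `cone(K)`
    have hY : IsCompact (β ⁻¹' (CosetSpace.mk H '' S)) :=
      hβ.1.isCompact_preimage (hS.image hC.continuous)
    have hSY : IsCompact ((fun p : G × L.Cone => p.1 * (s p.2)⁻¹) ''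
        S ×ˢ (β ⁻¹' (CosetSpace.mk H '' S))) :=
      (hS.prod hY).image (continuous_fst.mul (hs.comp continuous_snd).inv)
    have hX := hα.1.isCompact_preimage (hH.isClosedEmbedding_subtypeVal.isCompact_preimage hSY)
    obtain ⟨R₁, hR₁⟩ := hX.exists_bound_of_continuousOn
      (f := fun x : K.Cone => x.1) continuous_subtype_val.continuousOn
    obtain ⟨R₂, hR₂⟩ := hY.exists_bound_of_continuousOn
      (f := fun x : L.Cone => x.1) continuous_subtype_val.continuousOn
    refine (Cone.isCompact_norm_le (max R₁ R₂)).of_isClosed_subset (hS.isClosed.preimage hFc)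
      fun x hx => x.norm_le_max.trans ?_
    have hxr : x.right ∈ β ⁻¹' (CosetSpace.mk H '' S) := ⟨F x, hx, hFβ x⟩
    refine max_le_max (hR₁ _ ?_) (hR₂ _ hxr)
    exact ⟨(F x, x.right), ⟨hx, hxr⟩, by simp [hF]⟩
  · rintro σ ⟨-, hσl, hσr⟩ τ ⟨-, hτl, hτr⟩ hστ D
    have hl : Disjoint σ.toLeft τ.toLeft := Finset.disjoint_left.mpr fun v h1 h2 =>
      Finset.disjoint_left.mp hστ (Finset.mem_toLeft.mp h1) (Finset.mem_toLeft.mp h2)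
    have hr : Disjoint σ.toRight τ.toRight := Finset.disjoint_left.mpr fun v h1 h2 =>
      Finset.disjoint_left.mp hστ (Finset.mem_toRight.mp h1) (Finset.mem_toRight.mp h2)
    obtain ⟨R₂, hR₂⟩ := exists_norm_le_of_isProperExpanding hβ hσr hτr hr (C * D)
    obtain ⟨M, hM⟩ :=
      (((Cone.isCompact_norm_le (L := L) R₂).image hs).isBounded).subset_closedBall 1
    obtain ⟨R₁, hR₁⟩ := exists_norm_le_of_isProperExpanding hα hσl hτl hl (M + D + M)
    refine ⟨max R₁ R₂, fun x y hx hy hxy => x.norm_le_max.trans ?_⟩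
    have hβxy : dist (β x.right) (β y.right) ≤ C * D := by
      rw [← hFβ x, ← hFβ y]
      exact (hC.dist_le_mul _ _).trans (by gcongr)
    obtain ⟨hx2, hy2⟩ := hR₂ x.right y.right
      (fun w hw => hx _ fun h => hw (Finset.mem_toRight.mpr h))
      (fun w hw => hy _ fun h => hw (Finset.mem_toRight.mpr h)) hβxy
    -- by left invariance, `α x * s x` stays at bounded distance from `α x`
    have hd : ∀ z : (K.join L).Cone, ‖z.right.1‖ ≤ R₂ → dist (F z) (α z.left : G) ≤ M := by
      intro z hz
      have h1 : dist (s z.right) 1 ≤ M := hM ⟨_, hz, rfl⟩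
      rwa [← hleft (α z.left), mul_one] at h1
    have hαxy : dist (α x.left) (α y.left) ≤ M + D + M := by
      rw [Subtype.dist_eq]
      have h1 := hd x hx2
      have h2 := hd y hy2
      rw [dist_comm] at h1
      linarith [dist_triangle4 (α x.left : G) (F x) (F y) (α y.left)]
    exact max_le_max (hR₁ x.left y.left (fun v hv => hx _ fun h => hv (Finset.mem_toLeft.mpr h))
      (fun v hv => hy _ fun h => hv (Finset.mem_toLeft.mpr h)) hαxy).1 hx2

end Product

end AbstractSimplicialComplex

theorem mainTheorem7
    {E : Type*} [NormedAddCommGroup E] [NormedSpace ℝ E] [FiniteDimensional ℝ E]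
    -- a connected Lie group with a left invariant proper metric
    {G : Type*} [Group G] [MetricSpace G] [ProperSpace G] [ChartedSpace E G]
    [LieGroup 𝓘(ℝ, E) ∞ G] [ConnectedSpace G]
    (hleft : ∀ g x y : G, dist (g * x) (g * y) = dist x y)
    -- a closed subgroup, with the subspace metric
    (H : Subgroup G) (hH : IsClosed (H : Set G))
    -- the homogeneous space, with a proper metric that induces the quotient topology
    [MetricSpace (CosetSpace H)] [ProperSpace (CosetSpace H)]
    (hquot : IsQuotientMap (CosetSpace.mk H))
    (hlip : ∃ C : ℝ≥0, LipschitzWith C (CosetSpace.mk H))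
    [ContractibleSpace (CosetSpace H)]
    -- finite simplicial complexes and the given proper expanding maps
    {V W : Type*} [Fintype V] [Fintype W]
    (K_H : AbstractSimplicialComplex V) (K_Q : AbstractSimplicialComplex W)
    (α : K_H.Cone → H) (hα : IsProperExpanding α)
    (β : K_Q.Cone → CosetSpace H) (hβ : IsProperExpanding β) :
    ∃ F : (K_H.join K_Q).Cone → G,
      IsProperExpanding F ∧ Set.range F ⊆ CosetSpace.mk H ⁻¹' Set.range β := by
  have hG : IsTopologicalGroup G := topologicalGroup_of_lieGroup 𝓘(ℝ, E) ∞
  obtain ⟨B, hB, hinj, hnhds⟩ := LieGroup.exists_compact_slice (E := E) hH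
  obtain ⟨s, hs, hsβ⟩ := AbstractSimplicialComplex.Cone.exists_lift
    (CosetSpace.exists_local_section hquot hB hinj hnhds) hβ.1.continuous
  obtain ⟨C, hC⟩ := hlip
  refine ⟨_, AbstractSimplicialComplex.isProperExpanding_mul_lift hleft hH hC hα hβ hs hsβ, ?_⟩
  rintro _ ⟨x, rfl⟩
  exact ⟨x.right, by rw [CosetSpace.mk_mul_of_mem (α x.left).2, hsβ]⟩
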